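/- **Theorem.** Let $d \ge 1$. Let $BV([0,1]^d)$ be the space of (classes of) integrable functions $u : \mathbb{R}^d \to \mathbb{R}$ that vanish almost everywhere outside $[0,1]^d$ and have finite variation $$\|Du\|(\mathbb{R}^d) = \sup\Big\{ \int_{\mathbb{R}^d} u \operatorname{div} v \;:\; v \in C^1_c(\mathbb{R}^d;\mathbb{R}^d),\ |v(x)| \le 1 \text{ for all } x \Big\},$$ normed by $\|u\|_{BV} = \|u\|_1 + \|Du\|(\mathbb{R}^d)$. Every $u \in BV([0,1]^d)$ has a distributional gradient $Du$ that is an $\mathbb{R}^d$-valued Borel measure on $\mathbb{R}^d$, that is, $\int u \operatorname{div} v = -\int v \cdot dDu$ for all $v \in C^1_c(\mathbb{R}^d;\mathbb{R}^d)$. For every $f \in L^d([0,1]^d)$ the functional $T_f(u) = \int_{[0,1]^d} f u$ is well defined and belongs to the normed dual $BV([0,1]^d)^*$. Let $SCH([0,1]^d)$, the space of strong charge functionals, be the closure of $\{T_f : f \in L^d([0,1]^d)\}$ in $BV([0,1]^d)^*$. Then the formula $$(\mathfrak{div}\, v)(u) = -\int_{[0,1]^d} v \cdot dDu, \qquad u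 \in BV([0,1]^d),$$ defines a continuous linear operator $\mathfrak{div} : C([0,1]^d;\mathbb{R}^d) \to SCH([0,1]^d)$, and this operator is onto: for every strong charge functional $\alpha$ there is a continuous vector field $v : [0,1]^d \to \mathbb{R}^d$ with $\alpha(u) = -\int_{[0,1]^d} v \cdot dDu$ for all $u \in BV([0,1]^d)$. -/

import Mathlib

open MeasureTheory
open scoped ENNReal

noncomputable section

namespace StrongCharge

/-- The space `ℝ^d` with its Euclidean norm and Lebesgue measure. -/
abbrev Euc (d : ℕ) : Type := EuclideanSpace ℝ (Fin d)

/-- The closed unit cube `[0,1]^d`. -/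
def cube (d : ℕ) : Set (Euc d) := {x | ∀ i, x i ∈ Set.Icc (0 : ℝ) 1}

/-- The divergence `∑ i, ∂ᵢ vᵢ` of a (differentiable) vector field. -/
def divergence {d : ℕ} (v : Euc d → Euc d) (x : Euc d) : ℝ :=
  ∑ i, (fderiv ℝ v x (EuclideanSpace.single i 1)) i

/-- Compactly supported continuously differentiable vector fields, `C¹_c(ℝ^d; ℝ^d)`. -/
def IsTestField {d : ℕ} (v : Euc d → Euc d) : Prop :=
  ContDiff ℝ 1 v ∧ HasCompactSupport v

/-- The variation `‖Du‖(ℝ^d)`: the supremum of `∫ u div v` over the fields `v ∈ C¹_c(ℝ^d; ℝ^d)`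
with `|v| ≤ 1`. (The field `v = 0` is admissible, so nothing is lost by truncating at `0`.) -/
def variation {d : ℕ} (u : Euc d → ℝ) : ℝ≥0∞ :=
  ⨆ (v : Euc d → Euc d) (_ : IsTestField v) (_ : ∀ x, ‖v x‖ ≤ 1),
    ENNReal.ofReal (∫ x, u x * divergence v x)

lemma IsTestField.continuous_divergence {d : ℕ} {v : Euc d → Euc d} (hv : IsTestField v) :
    Continuous (divergence v) := by
  have h : Continuous (fderiv ℝ v) := hv.1.continuous_fderiv one_ne_zero
  unfold divergence
  fun_prop

lemma IsTestField.hasCompactSupport_divergence {d : ℕ} {v : Euc d → Euc d}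
    (hv : IsTestField v) : HasCompactSupport (divergence v) := by
  have h : HasCompactSupport (fderiv ℝ v) := hv.2.fderiv ℝ
  exact h.comp_left (g := fun L : Euc d →L[ℝ] Euc d =>
    ∑ i, (L (EuclideanSpace.single i 1)) i) (by simp)

lemma IsTestField.integrable_mul {d : ℕ} {v : Euc d → Euc d} (hv : IsTestField v)
    {u : Euc d → ℝ} (hu : Integrable u) : Integrable (fun x => u x * divergence v x) := by
  obtain ⟨C, hC⟩ := hv.hasCompactSupport_divergence.exists_bound_of_continuous
    hv.continuous_divergence
  exact hu.mul_bdd hv.continuous_divergence.aestronglyMeasurable (.of_forall hC)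

lemma variation_congr {d : ℕ} {u w : Euc d → ℝ} (h : u =ᵐ[volume] w) :
    variation u = variation w := by
  unfold variation
  have key : ∀ v : Euc d → Euc d,
      ∫ x, u x * divergence v x = ∫ x, w x * divergence v x := fun v =>
    integral_congr_ae (h.mono fun x hx => congrArg (· * divergence v x) hx)
  simp only [key]

lemma le_variation {d : ℕ} (u : Euc d → ℝ) {v : Euc d → Euc d} (hv : IsTestField v)
    (h1 : ∀ x, ‖v x‖ ≤ 1) :
    ENNReal.ofReal (∫ x, u x * divergence v x) ≤ variation u :=
  le_iSup_of_le v (le_iSup_of_le hv (le_iSup_of_le h1 le_rfl))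

lemma variation_zero {d : ℕ} : variation (fun _ : Euc d => (0 : ℝ)) = 0 := by
  simp [variation]

lemma variation_add_le {d : ℕ} {u w : Euc d → ℝ} (hu : Integrable u) (hw : Integrable w) :
    variation (u + w) ≤ variation u + variation w := by
  refine iSup_le fun v => iSup_le fun hv => iSup_le fun h1 => ?_
  have : ∫ x, (u + w) x * divergence v x
      = (∫ x, u x * divergence v x) + ∫ x, w x * divergence v x := by
    rw [← integral_add (hv.integrable_mul hu) (hv.integrable_mul hw)]
    simp only [Pi.add_apply, add_mul]
  rw [this]
  exact ENNReal.ofReal_add_le.trans (add_le_add (le_variation u hv h1) (le_variation w hv h1))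

lemma divergence_neg {d : ℕ} (v : Euc d → Euc d) (x : Euc d) :
    divergence (-v) x = -divergence v x := by
  simp [divergence, fderiv_neg]

lemma variation_smul_le {d : ℕ} (c : ℝ) (u : Euc d → ℝ) :
    variation (c • u) ≤ ENNReal.ofReal |c| * variation u := by
  refine iSup_le fun v => iSup_le fun hv => iSup_le fun h1 => ?_
  have key : ∫ x, (c • u) x * divergence v x = c * ∫ x, u x * divergence v x := by
    rw [← integral_const_mul]
    simp only [Pi.smul_apply, smul_eq_mul, mul_assoc]
  rw [key]
  rcases le_total 0 c with hc | hc
  · rw [abs_of_nonneg hc, ENNReal.ofReal_mul hc]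
    gcongr
    exact le_variation u hv h1
  · have hneg : c * ∫ x, u x * divergence v x = (-c) * ∫ x, u x * divergence (-v) x := by
      simp only [divergence_neg, mul_neg, integral_neg, neg_mul, neg_neg]
    rw [abs_of_nonpos hc, hneg, ENNReal.ofReal_mul (neg_nonneg.2 hc)]
    gcongr
    refine le_variation u ⟨hv.1.neg, hv.2.neg⟩ (fun x => ?_)
    simpa using h1 x

/-- The vector space `BV([0,1]^d)`: (classes of) integrable functions `u` on `ℝ^d` that vanish
almost everywhere outside `[0,1]^d` and satisfy `‖Du‖(ℝ^d) < ∞`. -/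
def bvSubmodule (d : ℕ) : Submodule ℝ (Lp ℝ 1 (volume : Measure (Euc d))) where
  carrier := {u | (∀ᵐ x, x ∉ cube d → u x = 0) ∧ variation (u : Euc d → ℝ) < ∞}
  zero_mem' := by
    refine ⟨(Lp.coeFn_zero ℝ 1 (volume : Measure (Euc d))).mono fun x hx _ => by simp [hx], ?_⟩
    rw [variation_congr (Lp.coeFn_zero ℝ 1 (volume : Measure (Euc d)))]
    exact (variation_zero (d := d)).trans_lt ENNReal.zero_lt_top
  add_mem' := by
    rintro u w ⟨hu, hu'⟩ ⟨hw, hw'⟩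
    refine ⟨?_, ?_⟩
    · filter_upwards [hu, hw, Lp.coeFn_add u w] with x h1 h2 h3 hx
      refine h3.trans ?_
      simp [h1 hx, h2 hx]
    · rw [variation_congr (Lp.coeFn_add u w)]
      exact (variation_add_le (L1.integrable_coeFn u) (L1.integrable_coeFn w)).trans_lt
        (ENNReal.add_lt_top.2 ⟨hu', hw'⟩)
  smul_mem' := by
    rintro c u ⟨hu, hu'⟩
    refine ⟨?_, ?_⟩
    · filter_upwards [hu, Lp.coeFn_smul c u] with x h1 h3 hx
      simp [h3, h1 hx]
    · rw [variation_congr (Lp.coeFn_smul c u)]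
      exact (variation_smul_le c u).trans_lt (ENNReal.mul_lt_top ENNReal.ofReal_lt_top hu')

/-- The space `BV([0,1]^d)`. It is a separate type because its norm is the `BV` norm below and
not the norm inherited from `L¹`. -/
def BV (d : ℕ) : Type := bvSubmodule d

instance (d : ℕ) : AddCommGroup (BV d) := inferInstanceAs (AddCommGroup (bvSubmodule d))

instance (d : ℕ) : Module ℝ (BV d) := inferInstanceAs (Module ℝ (bvSubmodule d))

/-- The class in `L¹(ℝ^d)` of an element of `BV([0,1]^d)`. -/
def BV.toL1 {d : ℕ} : BV d →ₗ[ℝ] Lp ℝ 1 (volume : Measure (Euc d)) := (bvSubmodule d).subtype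

instance (d : ℕ) : CoeFun (BV d) (fun _ => Euc d → ℝ) := ⟨fun u => BV.toL1 u⟩

lemma BV.variation_lt_top {d : ℕ} (u : BV d) : variation u < ∞ := u.2.2

/-- The norm `‖u‖_BV = ‖u‖₁ + ‖Du‖(ℝ^d)`. -/
def BV.groupNorm (d : ℕ) : AddGroupNorm (BV d) where
  toFun u := ‖BV.toL1 u‖ + (variation u).toReal
  map_zero' := by
    have h : variation (0 : BV d) = 0 := by
      rw [map_zero, variation_congr (Lp.coeFn_zero ℝ 1 (volume : Measure (Euc d)))]
      exact variation_zero
    rw [h]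
    simp
  add_le' u w := by
    have h : variation (u + w : BV d) ≤ variation u + variation w := by
      rw [map_add, variation_congr (Lp.coeFn_add _ _)]
      exact variation_add_le (L1.integrable_coeFn _) (L1.integrable_coeFn _)
    have h' := ENNReal.toReal_mono
      (ENNReal.add_lt_top.2 ⟨u.variation_lt_top, w.variation_lt_top⟩).ne h
    rw [ENNReal.toReal_add u.variation_lt_top.ne w.variation_lt_top.ne] at h'
    have h2 : ‖BV.toL1 (u + w)‖ ≤ ‖BV.toL1 u‖ + ‖BV.toL1 w‖ := by
      rw [map_add]
      exact norm_add_le _ _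
    linarith
  neg' u := by
    have h : ∀ w : BV d, variation (-w : BV d) ≤ variation w := fun w => by
      have := variation_smul_le (-1) (BV.toL1 w)
      rw [map_neg, variation_congr (Lp.coeFn_neg _)]
      simpa using this
    have h' : variation (-u : BV d) = variation u :=
      le_antisymm (h u) (by simpa only [neg_neg] using h (-u))
    rw [h', map_neg, norm_neg]
  eq_zero_of_map_eq_zero' u hu := by
    have h1 : ‖BV.toL1 u‖ = 0 := by
      have h2 := norm_nonneg (BV.toL1 u)
      have h3 : 0 ≤ (variation u).toReal := ENNReal.toReal_nonneg
      linarith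
    exact Subtype.ext (norm_eq_zero.1 h1)

instance (d : ℕ) : NormedAddCommGroup (BV d) := (BV.groupNorm d).toNormedAddCommGroup

lemma BV.norm_def {d : ℕ} (u : BV d) : ‖u‖ = ‖BV.toL1 u‖ + (variation u).toReal := rfl

instance (d : ℕ) : NormedSpace ℝ (BV d) where
  norm_smul_le c u := by
    rw [BV.norm_def, BV.norm_def, map_smul, norm_smul, mul_add,
      variation_congr (Lp.coeFn_smul c _)]
    have h := ENNReal.toReal_mono
      (ENNReal.mul_lt_top ENNReal.ofReal_lt_top u.variation_lt_top).ne
      (variation_smul_le c (BV.toL1 u))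
    rw [ENNReal.toReal_mul, ENNReal.toReal_ofReal (abs_nonneg c)] at h
    simpa using h

/-- The Euclidean inner product of `ℝ^d` as a continuous bilinear map. -/
def dotCLM (d : ℕ) : Euc d →L[ℝ] Euc d →L[ℝ] ℝ := innerSL ℝ

/-- The `ℝ^d`-valued Borel measure `μ` is the distributional gradient of `u`:
`∫ u div v = - ∫ v · dμ` for all `v ∈ C¹_c(ℝ^d; ℝ^d)`. -/
def IsGradient {d : ℕ} (u : Euc d → ℝ) (μ : VectorMeasure (Euc d) (Euc d)) : Prop :=
  ∀ v : Euc d → Euc d, IsTestField v →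
    ∫ x, u x * divergence v x = -(μ.integral v (dotCLM d))

open Classical in
/-- The distributional gradient `Du` of `u ∈ BV([0,1]^d)`, an `ℝ^d`-valued Borel measure on
`ℝ^d` (such a measure exists and is unique). -/
def BV.grad {d : ℕ} (u : BV d) : VectorMeasure (Euc d) (Euc d) :=
  if h : ∃ μ, IsGradient u μ then h.choose else 0

/-- The functional `u ↦ - ∫_{[0,1]^d} v · dDu` on `BV([0,1]^d)` attached to a continuous vector
field `v` on `[0,1]^d`. Values of the integrand outside `[0,1]^d` are irrelevant. -/
def fracDiv {d : ℕ} (v : C(cube d, Euc d)) (u : BV d) : ℝ :=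
  -((u.grad.restrict (cube d)).integral (Function.extend Subtype.val v 0) (dotCLM d))

/-- `α = T_f`, that is, `α(u) = ∫_{[0,1]^d} f u` for all `u ∈ BV([0,1]^d)`. -/
def Represents {d : ℕ} (f : Euc d → ℝ) (α : StrongDual ℝ (BV d)) : Prop :=
  ∀ u : BV d, IntegrableOn (fun x => f x * u x) (cube d) ∧ α u = ∫ x in cube d, f x * u x

/-- The range of `T : L^d([0,1]^d) → BV([0,1]^d)^*`, `f ↦ T_f`. -/
def rangeT (d : ℕ) : Submodule ℝ (StrongDual ℝ (BV d)) where
  carrier := {α | ∃ f : Euc d → ℝ, MemLp f d (volume.restrict (cube d)) ∧ Represents f α}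
  zero_mem' := ⟨0, MemLp.zero, fun u => by simp⟩
  add_mem' := by
    rintro α β ⟨f, hf, hα⟩ ⟨g, hg, hβ⟩
    refine ⟨f + g, hf.add hg, fun u => ?_⟩
    have h : (fun x => (f + g) x * u x) = fun x => f x * u x + g x * u x := by
      funext x
      simp [add_mul]
    rw [h]
    refine ⟨(hα u).1.add (hβ u).1, ?_⟩
    rw [integral_add (hα u).1 (hβ u).1, ← (hα u).2, ← (hβ u).2]
    rfl
  smul_mem' := by
    rintro c α ⟨f, hf, hα⟩
    refine ⟨c • f, hf.const_smul c, fun u => ?_⟩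
    have h : (fun x => (c • f) x * u x) = fun x => c * (f x * u x) := by
      funext x
      simp [mul_assoc]
    rw [h]
    refine ⟨(hα u).1.const_mul c, ?_⟩
    rw [integral_const_mul, ← (hα u).2]
    rfl

/-- The space `SCH([0,1]^d)` of strong charge functionals: the closure of the range of `T` in
the normed dual `BV([0,1]^d)^*`. -/
def SCH (d : ℕ) : Submodule ℝ (StrongDual ℝ (BV d)) := (rangeT d).topologicalClosure

end StrongCharge

end

open StrongCharge

/-! For a test field `w`, integration by parts turns `𝔡𝔦𝔳 w` into the charge `T_f` with `f = div w`,
and `∫ u div w ≤ sup |w| · ‖Du‖`. Test fields are uniformly dense in the continuous fields on the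
cube, so `𝔡𝔦𝔳` is bounded and takes values in the closure of the charges `T_f`. Restricting `Du` to
the closed cube loses nothing in these pairings (`BV.integral_grad_indicator`).

Mollification transfers the Gagliardo–Nirenberg–Sobolev inequality to `BV`: it embeds in `L^p` with
`1/d + 1/p = 1`. By Hölder every `T_f` is then bounded, and on the cube the Poincaré inequality `‖u‖
≤ C ‖Du‖` follows. The measure `Du` is a weak limit of gradients of mollifications.

Surjectivity is a duality argument. By successive approximation it is enough that each `α = T_f`
lies in the closure of the image under `𝔡𝔦𝔳` of the ball of radius `C ‖α‖`
(`exists_mem_closure_image`). Otherwise Hahn–Banach separates `α` from that closure by some `ξ` in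
the bidual of `BV`. Since `d < ∞`, the functional `ξ ∘ T` on `L^d` has an integrable density `u` by
Radon–Nikodym. The bound for `ξ` on the image of the ball bounds the variation of `u`; so `u` is in
`BV` and `ξ` is evaluation at `u` on all charges `T_f` (`exists_eval_of_bound`). Then `ξ α = α u ≤
‖α‖ ‖u‖ ≤ C ‖α‖ ‖Du‖` contradicts the separation. -/

noncomputable section

namespace StrongCharge

open Filter Topology Set ContinuousLinearMap
open scoped Convolution ContDiff NNReal Pointwise Manifold

variable {d : ℕ}

/-! ### Mollification -/

/-- The mollification of `u` by the normalized bump function `φ`. -/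
def mollify (φ : ContDiffBump (0 : Euc d)) (u : Euc d → ℝ) : Euc d → ℝ :=
  φ.normed volume ⋆[lsmul ℝ ℝ, volume] u

lemma mollify_apply (φ : ContDiffBump (0 : Euc d)) (u : Euc d → ℝ) (x : Euc d) :
    mollify φ u x = ∫ y, φ.normed volume y * u (x - y) := rfl

lemma contDiff_mollify (φ : ContDiffBump (0 : Euc d)) {u : Euc d → ℝ} (hu : Integrable u) :
    ContDiff ℝ ∞ (mollify φ u) :=
  φ.hasCompactSupport_normed.contDiff_convolution_left _ φ.contDiff_normed hu.locallyIntegrable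

lemma integrable_mollify (φ : ContDiffBump (0 : Euc d)) {u : Euc d → ℝ} (hu : Integrable u) :
    Integrable (mollify φ u) :=
  φ.integrable_normed.integrable_convolution _ hu

lemma integral_mollify_mul (φ : ContDiffBump (0 : Euc d)) {u g : Euc d → ℝ} (hu : Integrable u)
    (hg : Continuous g) {C : ℝ} (hC : ∀ x, ‖g x‖ ≤ C) :
    ∫ x, mollify φ u x * g x = ∫ y, φ.normed volume y * ∫ x, u x * g (x + y) := by
  have hint : Integrable (fun p : Euc d × Euc d => φ.normed volume p.2 * u (p.1 - p.2) * g p.1)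
      (volume.prod volume) := by
    refine Integrable.mul_bdd (c := C) ?_ ?_ (.of_forall fun p => hC p.1)
    · exact φ.integrable_normed.convolution_integrand (lsmul ℝ ℝ) hu
    · exact (hg.comp continuous_fst).aestronglyMeasurable
  calc ∫ x, mollify φ u x * g x
      = ∫ x, ∫ y, φ.normed volume y * u (x - y) * g x := by
        simp_rw [mollify_apply, ← integral_mul_const]
    _ = ∫ y, ∫ x, φ.normed volume y * u (x - y) * g x := integral_integral_swap hint
    _ = ∫ y, φ.normed volume y * ∫ x, u x * g (x + y) := by
        congr 1 with y
        rw [← integral_sub_right_eq_self (fun x => u x * g (x + y)) y, ← integral_const_mul]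
        simp [mul_assoc]

lemma continuous_integral_mul_translate {u g : Euc d → ℝ} (hu : Integrable u)
    (hg : Continuous g) {C : ℝ} (hC : ∀ x, ‖g x‖ ≤ C) :
    Continuous fun y => ∫ x, u x * g (x + y) := by
  refine continuous_of_dominated (bound := fun x => ‖u x‖ * C) (fun y => ?_)
    (fun y => .of_forall fun x => ?_) (hu.norm.mul_const C) (.of_forall fun x => ?_)
  · exact hu.1.mul (by fun_prop : Continuous fun x => g (x + y)).aestronglyMeasurable
  · rw [norm_mul]
    gcongr
    exact hC _
  · fun_prop

lemma tendsto_integral_mollify_mul {φ : ℕ → ContDiffBump (0 : Euc d)}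
    (hφ : Tendsto (fun n => (φ n).rOut) atTop (𝓝 0)) {u g : Euc d → ℝ} (hu : Integrable u)
    (hg : Continuous g) {C : ℝ} (hC : ∀ x, ‖g x‖ ≤ C) :
    Tendsto (fun n => ∫ x, mollify (φ n) u x * g x) atTop (𝓝 (∫ x, u x * g x)) := by
  have hG := continuous_integral_mul_translate hu hg hC
  -- With `G y = ∫ u(x) g(x + y) dx`, the integral `∫ φ G` is the convolution of `φ` with `G(-·)` at
  -- the origin.
  have := ContDiffBump.convolution_tendsto_right_of_continuous (μ := volume) hφ
    (hG.comp continuous_neg) (0 : Euc d)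
  simpa [integral_mollify_mul _ hu hg hC, convolution_def] using this

lemma IsTestField.translate {v : Euc d → Euc d} (hv : IsTestField v) (y : Euc d) :
    IsTestField (fun x => v (x + y)) :=
  ⟨hv.1.comp (contDiff_id.add contDiff_const), hv.2.comp_homeomorph (Homeomorph.addRight y)⟩

lemma divergence_translate (v : Euc d → Euc d) (x y : Euc d) :
    divergence (fun x => v (x + y)) x = divergence v (x + y) := by
  simp [divergence, fderiv_comp_add_right]

lemma IsTestField.exists_bound_divergence {v : Euc d → Euc d} (hv : IsTestField v) :
    ∃ C, ∀ x, ‖divergence v x‖ ≤ C :=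
  hv.hasCompactSupport_divergence.exists_bound_of_continuous hv.continuous_divergence

lemma integral_mul_divergence_le {u : Euc d → ℝ} (hu : variation u < ⊤) {v : Euc d → Euc d}
    (hv : IsTestField v) (h1 : ∀ x, ‖v x‖ ≤ 1) :
    ∫ x, u x * divergence v x ≤ (variation u).toReal :=
  (ENNReal.ofReal_le_iff_le_toReal hu.ne).1 (le_variation u hv h1)

/-- Pairing the mollification with `div v` averages, with weight `φ`, the pairings of `u` with the
translates of `v`, all of which are admissible. -/
lemma variation_mollify_le (φ : ContDiffBump (0 : Euc d)) {u : Euc d → ℝ} (hu : Integrable u) :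
    variation (mollify φ u) ≤ variation u := by
  by_cases hV : variation u = ⊤
  · simp [hV]
  refine iSup_le fun v => iSup_le fun hv => iSup_le fun h1 => ?_
  rw [ENNReal.ofReal_le_iff_le_toReal hV]
  obtain ⟨C, hC⟩ := hv.exists_bound_divergence
  rw [integral_mollify_mul φ hu hv.continuous_divergence hC]
  have hG := continuous_integral_mul_translate hu hv.continuous_divergence hC
  calc ∫ y, φ.normed volume y * ∫ x, u x * divergence v (x + y)
      ≤ ∫ y, φ.normed volume y * (variation u).toReal := by
        refine integral_mono ?_ (φ.integrable_normed.mul_const _) fun y => ?_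
        · exact (φ.continuous_normed.mul hG).integrable_of_hasCompactSupport
            φ.hasCompactSupport_normed.mul_right
        · have := integral_mul_divergence_le (lt_top_iff_ne_top.2 hV) (hv.translate y)
            (fun x => h1 (x + y))
          simp_rw [divergence_translate] at this
          exact mul_le_mul_of_nonneg_left this (φ.nonneg_normed y)
    _ = (variation u).toReal := by
        rw [integral_mul_const, φ.integral_normed, one_mul]

/-! ### Partial derivatives and their `L¹` bound by the variation -/

/-- The `i`-th partial derivative. -/
def partialDeriv (i : Fin d) (w : Euc d → ℝ) (x : Euc d) : ℝ :=
  fderiv ℝ w x (EuclideanSpace.single i 1)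

lemma contDiff_partialDeriv {w : Euc d → ℝ} (hw : ContDiff ℝ ∞ w) (i : Fin d) :
    ContDiff ℝ ∞ (partialDeriv i w) :=
  (hw.fderiv_right (m := ∞) (by simp)).clm_apply contDiff_const

lemma hasCompactSupport_partialDeriv {w : Euc d → ℝ} (hw : HasCompactSupport w) (i : Fin d) :
    HasCompactSupport (partialDeriv i w) :=
  (hw.fderiv ℝ).comp_left (g := fun L : Euc d →L[ℝ] ℝ => L (EuclideanSpace.single i 1)) (by simp)

lemma divergence_eq_sum_partialDeriv {v : Euc d → Euc d} (hv : Differentiable ℝ v) (x : Euc d) :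
    divergence v x = ∑ i, partialDeriv i (fun y => v y i) x := by
  refine Finset.sum_congr rfl fun i _ => ?_
  have : HasFDerivAt (fun y => v y i) ((EuclideanSpace.proj i).comp (fderiv ℝ v x)) x :=
    (EuclideanSpace.proj (𝕜 := ℝ) i).hasFDerivAt.comp x (hv x).hasFDerivAt
  simp [partialDeriv, this.fderiv]

lemma divergence_smul_single {g : Euc d → ℝ} (hg : Differentiable ℝ g) (i : Fin d) (x : Euc d) :
    divergence (fun y => g y • EuclideanSpace.single i (1 : ℝ)) x = partialDeriv i g x := by
  rw [divergence, Finset.sum_eq_single i]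
  · rw [fderiv_smul_const (hg x)]
    simp [partialDeriv]
  · intro j _ hj
    rw [fderiv_smul_const (hg x)]
    simp [hj]
  · simp

lemma integral_mul_partialDeriv {w g : Euc d → ℝ} (hw : ContDiff ℝ 1 w) (hg : ContDiff ℝ 1 g)
    (hwc : HasCompactSupport w) (i : Fin d) :
    ∫ x, w x * partialDeriv i g x = -∫ x, partialDeriv i w x * g x := by
  have h1 := hw.continuous
  have h2 := hg.continuous
  have h3 := hw.continuous_fderiv one_ne_zero
  have h4 := hg.continuous_fderiv one_ne_zero
  refine integral_mul_fderiv_eq_neg_fderiv_mul_of_integrable ?_ ?_ ?_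
    (fun x _ => hw.differentiable one_ne_zero x) (fun x _ => hg.differentiable one_ne_zero x)
  · exact Continuous.integrable_of_hasCompactSupport (by fun_prop)
      (hasCompactSupport_partialDeriv hwc i).mul_right
  · exact Continuous.integrable_of_hasCompactSupport (by fun_prop) hwc.mul_right
  · exact Continuous.integrable_of_hasCompactSupport (by fun_prop) hwc.mul_right

lemma abs_sub_sq_div_sqrt_le (h : ℝ) {δ : ℝ} (hδ : 0 < δ) :
    |h| - h * (h / √(h ^ 2 + δ ^ 2)) ≤ δ := by
  have hs : 0 < √(h ^ 2 + δ ^ 2) := by positivity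
  have h2 : |h| ≤ √(h ^ 2 + δ ^ 2) := Real.abs_le_sqrt (by nlinarith)
  have h3 : √(h ^ 2 + δ ^ 2) ≤ |h| + δ :=
    Real.sqrt_le_iff.2 ⟨by positivity, by nlinarith [abs_nonneg h, sq_abs h]⟩
  have h4 : |h| - δ ≤ h * (h / √(h ^ 2 + δ ^ 2)) := by
    rw [← mul_div_assoc, le_div_iff₀ hs]
    rcases le_total |h| δ with h5 | h5
    · nlinarith [mul_self_nonneg h]
    · nlinarith [abs_mul_abs_self h]
  linarith

/-- The field `-sign(∂ᵢ w) eᵢ` would give the bound at once; it is replaced by a `C¹`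
regularization, which costs `δ` at each point of the support of `∂ᵢ w`. -/
lemma integral_abs_partialDeriv_le {w : Euc d → ℝ} (hw : ContDiff ℝ ∞ w)
    (hwc : HasCompactSupport w) (hV : variation w < ⊤) (i : Fin d) :
    ∫ x, |partialDeriv i w x| ≤ (variation w).toReal := by
  set h := partialDeriv i w with hh
  have hsm : ContDiff ℝ ∞ h := contDiff_partialDeriv hw i
  have hcs : HasCompactSupport h := hasCompactSupport_partialDeriv hwc i
  have hint : Integrable fun x => |h x| :=
    (hsm.continuous.integrable_of_hasCompactSupport hcs).abs
  have key : ∀ δ : ℝ, 0 < δ →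
      ∫ x, |h x| ≤ (variation w).toReal + δ * volume.real (tsupport h) := by
    intro δ hδ
    set g : Euc d → ℝ := fun x => h x / √(h x ^ 2 + δ ^ 2) with hgdef
    have hpos : ∀ x, 0 < h x ^ 2 + δ ^ 2 := fun x => by positivity
    have hg : ContDiff ℝ 1 g := by
      have h1 : ContDiff ℝ 1 h := hsm.of_le (by simp)
      exact h1.div (((h1.pow 2).add contDiff_const).sqrt fun x => (hpos x).ne')
        fun x => (Real.sqrt_pos.2 (hpos x)).ne'
    have hgc : HasCompactSupport g := by
      refine hcs.mono fun x hx => ?_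
      contrapose! hx
      simp only [Function.mem_support, not_not] at hx ⊢
      simp [g, hx]
    have hg1 : ∀ x, |g x| ≤ 1 := fun x => by
      rw [abs_div, abs_of_nonneg (Real.sqrt_nonneg _)]
      exact div_le_one_of_le₀ (Real.abs_le_sqrt (by nlinarith)) (Real.sqrt_nonneg _)
    have htest : IsTestField fun x => (-g x) • EuclideanSpace.single i (1 : ℝ) :=
      ⟨hg.neg.smul contDiff_const, hgc.neg.smul_right⟩
    have h2 := integral_mul_divergence_le hV htest fun x => by
      simpa [norm_smul] using hg1 x
    have h3 : ∀ x, divergence (fun y => (-g y) • EuclideanSpace.single i (1 : ℝ)) x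
        = partialDeriv i (fun y => -g y) x := fun x =>
      divergence_smul_single (hg.neg.differentiable one_ne_zero) i x
    simp_rw [h3] at h2
    rw [integral_mul_partialDeriv (hw.of_le (by simp)) hg.neg hwc, ← hh] at h2
    simp only [mul_neg, integral_neg, neg_neg] at h2
    have hfin : volume (tsupport h) < ⊤ := hcs.isCompact.measure_lt_top
    have hint2 : Integrable fun x => h x * g x :=
      (hsm.continuous.mul hg.continuous).integrable_of_hasCompactSupport hcs.mul_right
    have h4 : ∫ x, (|h x| - h x * g x) ≤ ∫ x, (tsupport h).indicator (fun _ => δ) x := by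
      refine integral_mono (hint.sub hint2) ?_ fun x => ?_
      · exact (integrableOn_const hfin.ne).integrable_indicator (isClosed_tsupport h).measurableSet
      · by_cases hx : x ∈ tsupport h
        · simpa [hx] using abs_sub_sq_div_sqrt_le (h x) hδ
        · simp [hx, image_eq_zero_of_notMem_tsupport hx]
    rw [integral_sub hint hint2, integral_indicator_const _ (isClosed_tsupport h).measurableSet,
      smul_eq_mul] at h4
    linarith
  refine le_of_forall_pos_le_add fun ε hε => ?_
  have hM : 0 ≤ volume.real (tsupport h) := measureReal_nonneg
  refine (key (ε / (volume.real (tsupport h) + 1)) (by positivity)).trans ?_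
  gcongr
  rw [div_mul_eq_mul_div, div_le_iff₀ (by positivity)]
  nlinarith

/-! ### The cube and a fixed mollifying sequence -/

lemma isClosed_cube (d : ℕ) : IsClosed (cube d) := by
  have : cube d = ⋂ i, (fun x : Euc d => x i) ⁻¹' Icc (0 : ℝ) 1 := by
    ext x
    simp [cube]
  rw [this]
  exact isClosed_iInter fun i => isClosed_Icc.preimage (by fun_prop)

lemma isCompact_cube (d : ℕ) : IsCompact (cube d) := by
  refine Metric.isCompact_of_isClosed_isBounded (isClosed_cube d) ?_
  refine (Metric.isBounded_closedBall (x := (0 : Euc d)) (r := √d)).subset fun x hx => ?_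
  rw [mem_closedBall_zero_iff, EuclideanSpace.norm_eq]
  refine Real.sqrt_le_sqrt ?_
  calc ∑ i, ‖x i‖ ^ 2 ≤ ∑ _i : Fin d, (1 : ℝ) := Finset.sum_le_sum fun i _ => by
        rw [Real.norm_eq_abs, abs_of_nonneg (hx i).1]
        nlinarith [(hx i).1, (hx i).2]
    _ = d := by simp

lemma measurableSet_cube (d : ℕ) : MeasurableSet (cube d) := (isClosed_cube d).measurableSet

/-- A sequence of bump functions with supports shrinking to the origin. -/
def bump (d : ℕ) (n : ℕ) : ContDiffBump (0 : Euc d) where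
  rIn := 1 / (n + 1)
  rOut := 2 / (n + 1)
  rIn_pos := by positivity
  rIn_lt_rOut := by gcongr; norm_num

lemma tendsto_rOut_bump (d : ℕ) : Tendsto (fun n => (bump d n).rOut) atTop (𝓝 0) := by
  have := (tendsto_one_div_add_atTop_nhds_zero_nat (𝕜 := ℝ)).const_mul 2
  simpa [bump, div_eq_mul_inv] using this

lemma rOut_bump_le_two (d n : ℕ) : (bump d n).rOut ≤ 2 :=
  div_le_self zero_le_two (by simp)

lemma ae_tendsto_mollify_bump {u : Euc d → ℝ} (hu : Integrable u) :
    ∀ᵐ x, Tendsto (fun n => mollify (bump d n) u x) atTop (𝓝 (u x)) :=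
  ContDiffBump.ae_convolution_tendsto_right_of_locallyIntegrable (K := 2) (tendsto_rOut_bump d)
    (.of_forall fun n => by simp [bump, div_eq_mul_inv]) hu.locallyIntegrable

/-- A compact set which contains the supports of all mollifications of functions supported in
the cube. -/
def bigCube (d : ℕ) : Set (Euc d) := Metric.closedBall 0 2 + cube d

lemma isCompact_bigCube (d : ℕ) : IsCompact (bigCube d) :=
  (isCompact_closedBall _ _).add (isCompact_cube d)

lemma tsupport_mollify_subset {u : Euc d → ℝ} (hu : ∀ x ∉ cube d, u x = 0) (n : ℕ) :
    tsupport (mollify (bump d n) u) ⊆ bigCube d := by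
  refine closure_minimal ?_ (isCompact_bigCube d).isClosed
  refine (support_convolution_subset_swap _).trans ?_
  rw [bigCube, add_comm (Metric.closedBall _ _)]
  refine add_subset_add (fun x hx => ?_) ?_
  · by_contra h
    exact hx (hu x h)
  · rw [ContDiffBump.support_normed_eq]
    exact Metric.ball_subset_closedBall.trans (Metric.closedBall_subset_closedBall
      (rOut_bump_le_two d n))

lemma hasCompactSupport_mollify {u : Euc d → ℝ} (hu : ∀ x ∉ cube d, u x = 0) (n : ℕ) :
    HasCompactSupport (mollify (bump d n) u) :=
  (isCompact_bigCube d).of_isClosed_subset (isClosed_tsupport _) (tsupport_mollify_subset hu n)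

/-! ### The Sobolev inequality for `BV` -/

lemma norm_le_sum_abs_single (L : Euc d →L[ℝ] ℝ) :
    ‖L‖ ≤ ∑ i, |L (EuclideanSpace.single i 1)| := by
  refine L.opNorm_le_bound (by positivity) fun x => ?_
  have hx : x = ∑ i, x i • EuclideanSpace.single i (1 : ℝ) := by
    ext j
    simp [Finset.sum_apply, Pi.single_apply]
  conv_lhs => rw [hx, map_sum]
  rw [Finset.sum_mul]
  refine (norm_sum_le _ _).trans (Finset.sum_le_sum fun i _ => ?_)
  rw [map_smul, norm_smul, mul_comm, Real.norm_eq_abs]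
  gcongr
  exact PiLp.norm_apply_le x i

lemma eLpNorm_fderiv_one_le {w : Euc d → ℝ} (hw : ContDiff ℝ ∞ w) (hwc : HasCompactSupport w)
    (hV : variation w < ⊤) : eLpNorm (fderiv ℝ w) 1 volume ≤ d * variation w := by
  have hi : ∀ i, Integrable (partialDeriv i w) := fun i =>
    (contDiff_partialDeriv hw i).continuous.integrable_of_hasCompactSupport
      (hasCompactSupport_partialDeriv hwc i)
  calc eLpNorm (fderiv ℝ w) 1 volume
      = ∫⁻ x, ‖fderiv ℝ w x‖ₑ := eLpNorm_one_eq_lintegral_enorm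
    _ ≤ ∫⁻ x, ∑ i, ‖partialDeriv i w x‖ₑ := by
        refine lintegral_mono fun x => ?_
        have := norm_le_sum_abs_single (fderiv ℝ w x)
        rw [← ofReal_norm, ← ENNReal.ofReal_toReal (a := ∑ i, ‖partialDeriv i w x‖ₑ) (by simp)]
        refine ENNReal.ofReal_le_ofReal (this.trans (le_of_eq ?_))
        rw [ENNReal.toReal_sum (by simp)]
        simp [partialDeriv]
    _ = ∑ i, ∫⁻ x, ‖partialDeriv i w x‖ₑ :=
        lintegral_finsetSum' _ fun i _ => (hi i).1.enorm
    _ ≤ ∑ _i : Fin d, variation w := by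
        refine Finset.sum_le_sum fun i _ => ?_
        rw [← ofReal_integral_norm_eq_lintegral_enorm (hi i)]
        exact ENNReal.ofReal_le_of_le_toReal (integral_abs_partialDeriv_le hw hwc hV i)
    _ = d * variation w := by simp

/-- The endpoint `d = 1`, where the conjugate exponent is `∞`: the value at a point is controlled by
the integral of the derivative over a half-line. -/
lemma eLpNorm_top_le_eLpNorm_fderiv_one {w : Euc 1 → ℝ} (hw : ContDiff ℝ 1 w)
    (hwc : HasCompactSupport w) : eLpNorm w ⊤ volume ≤ eLpNorm (fderiv ℝ w) 1 volume := by
  rw [eLpNorm_exponent_top, eLpNorm_one_eq_lintegral_enorm]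
  refine eLpNormEssSup_le_of_ae_enorm_bound (.of_forall fun x => ?_)
  let e : ℝ ≃ₗᵢ[ℝ] Euc 1 := (OrthonormalBasis.singleton (Fin 1) ℝ).repr
  have h := HasCompactSupport.enorm_le_lintegral_Ici_deriv (f := w ∘ e)
    (hw.comp e.contDiff) (hwc.comp_homeomorph e.toHomeomorph) (e.symm x)
  simp only [Function.comp_apply, LinearIsometryEquiv.apply_symm_apply] at h
  refine h.trans ((setLIntegral_le_lintegral _ _).trans ?_)
  rw [← e.measurePreserving.lintegral_comp_emb e.toHomeomorph.measurableEmbedding]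
  refine lintegral_mono fun t => ?_
  have h2 : HasDerivAt (w ∘ e) (fderiv ℝ w (e t) (e 1)) t := by
    have h3 := (hw.differentiable one_ne_zero (e t)).hasFDerivAt.comp t
      e.toContinuousLinearEquiv.hasFDerivAt
    exact h3.hasDerivAt
  rw [h2.deriv, enorm_le_iff_norm_le]
  refine (le_opNorm _ _).trans ?_
  simp

lemma exists_sobolev_exponent (hd : 1 ≤ d) :
    ∃ (p : ℝ≥0∞) (C : ℝ≥0), ENNReal.HolderConjugate d p ∧
      ∀ w : Euc d → ℝ, ContDiff ℝ 1 w → HasCompactSupport w →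
        eLpNorm w p volume ≤ C * eLpNorm (fderiv ℝ w) 1 volume := by
  rcases hd.eq_or_lt with rfl | hd
  · refine ⟨⊤, 1, by simpa using ENNReal.HolderConjugate.one_top, fun w hw hwc => ?_⟩
    simpa using eLpNorm_top_le_eLpNorm_fderiv_one hw hwc
  · have h1 : (1 : ℝ≥0) < d := by exact_mod_cast hd
    have h := NNReal.HolderConjugate.conjExponent h1
    refine ⟨_, eLpNormLESNormFDerivOneConst (volume : Measure (Euc d)) (NNReal.conjExponent d),
      by simpa using h.coe_ennreal, fun w hw hwc => ?_⟩
    exact eLpNorm_le_eLpNorm_fderiv_one volume hw hwc (by simpa using h)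

/-- The Gagliardo–Nirenberg–Sobolev inequality for functions of bounded variation. -/
theorem exists_eLpNorm_le_variation (hd : 1 ≤ d) :
    ∃ (p : ℝ≥0∞) (C : ℝ≥0), ENNReal.HolderConjugate d p ∧
      ∀ u : Euc d → ℝ, Integrable u → (∀ x ∉ cube d, u x = 0) → variation u < ⊤ →
        eLpNorm u p volume ≤ C * variation u := by
  obtain ⟨p, C, hp, h⟩ := exists_sobolev_exponent hd
  refine ⟨p, C * d, hp, fun u hu h0 hV => ?_⟩
  -- Fatou: the mollifications converge almost everywhere, so a bound uniform in `n` passes to the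
  -- limit.
  refine (Lp.eLpNorm_lim_le_liminf_eLpNorm (f := fun n => mollify (bump d n) u)
    (fun n => (integrable_mollify _ hu).1) u (ae_tendsto_mollify_bump hu)).trans ?_
  refine liminf_le_of_frequently_le (Eventually.frequently (.of_forall fun n => ?_))
  have hm := contDiff_mollify (bump d n) hu
  have hc := hasCompactSupport_mollify h0 n
  have hVn := variation_mollify_le (bump d n) hu
  calc _ ≤ C * eLpNorm (fderiv ℝ (mollify (bump d n) u)) 1 volume := h _ (hm.of_le (by simp)) hc
    _ ≤ C * (d * variation (mollify (bump d n) u)) := by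
        gcongr
        exact eLpNorm_fderiv_one_le hm hc (hVn.trans_lt hV)
    _ ≤ C * (d * variation u) := by gcongr
    _ = _ := by push_cast; ring

/-! ### Elements of `BV` and the Poincaré inequality -/

lemma BV.integrable (u : BV d) : Integrable (u : Euc d → ℝ) := L1.integrable_coeFn _

lemma BV.ae_eq_indicator (u : BV d) : (u : Euc d → ℝ) =ᵐ[volume] (cube d).indicator u := by
  filter_upwards [u.2.1] with x hx
  by_cases h : x ∈ cube d
  · simp [h]
  · rw [indicator_of_notMem h]
    exact hx h

lemma BV.integrable_indicator (u : BV d) : Integrable ((cube d).indicator u) :=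
  u.integrable.indicator (measurableSet_cube d)

lemma BV.indicator_eq_zero (u : BV d) : ∀ x ∉ cube d, (cube d).indicator u x = 0 :=
  fun _ hx => indicator_of_notMem hx _

lemma BV.variation_indicator (u : BV d) : variation ((cube d).indicator u) = variation u :=
  (variation_congr u.ae_eq_indicator).symm

lemma BV.setIntegral_mul (u : BV d) (f : Euc d → ℝ) :
    ∫ x in cube d, f x * u x = ∫ x, f x * u x := by
  refine setIntegral_eq_integral_of_ae_compl_eq_zero ?_
  filter_upwards [u.2.1] with x hx h
  have : u x = 0 := hx h
  simp [this]

lemma BV.toReal_variation_le_norm (u : BV d) : (variation u).toReal ≤ ‖u‖ := by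
  rw [BV.norm_def]
  linarith [norm_nonneg (BV.toL1 u)]

/-- The class in `BV([0,1]^d)` of an integrable function of finite variation which vanishes
outside the cube. -/
def BV.mk (u : Euc d → ℝ) (hu : Integrable u) (h0 : ∀ x ∉ cube d, u x = 0)
    (hV : variation u < ⊤) : BV d :=
  ⟨hu.toL1 u, by
    refine ⟨?_, ?_⟩
    · filter_upwards [hu.coeFn_toL1] with x hx h
      rw [hx, h0 x h]
    · rwa [variation_congr hu.coeFn_toL1]⟩

lemma BV.coeFn_mk {u : Euc d → ℝ} (hu : Integrable u) (h0 : ∀ x ∉ cube d, u x = 0)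
    (hV : variation u < ⊤) : (BV.mk u hu h0 hV : Euc d → ℝ) =ᵐ[volume] u :=
  hu.coeFn_toL1

lemma BV.exists_eLpNorm_le_variation (hd : 1 ≤ d) :
    ∃ (p : ℝ≥0∞) (C : ℝ≥0), ENNReal.HolderConjugate d p ∧
      ∀ u : BV d, eLpNorm u p volume ≤ C * variation u := by
  obtain ⟨p, C, hp, h⟩ := StrongCharge.exists_eLpNorm_le_variation hd
  refine ⟨p, C, hp, fun u => ?_⟩
  rw [eLpNorm_congr_ae u.ae_eq_indicator, ← u.variation_indicator]
  exact h _ u.integrable_indicator u.indicator_eq_zero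
    (u.variation_indicator ▸ u.variation_lt_top)

/-- The Poincaré inequality for functions of bounded variation supported in the cube. -/
lemma BV.exists_norm_le_variation (hd : 1 ≤ d) :
    ∃ C : ℝ, 0 < C ∧ ∀ u : BV d, ‖u‖ ≤ C * (variation u).toReal := by
  obtain ⟨p, C, hp, h⟩ := BV.exists_eLpNorm_le_variation hd
  have hp1 : 1 ≤ p := hp.symm.one_le
  -- `M` is the Hölder constant of the inclusion of `L^p` in `L¹` on the cube.
  set M : ℝ≥0∞ := volume (cube d) ^ (1 / (1 : ℝ≥0∞).toReal - 1 / p.toReal) with hM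
  have hexp : 0 ≤ 1 / (1 : ℝ≥0∞).toReal - 1 / p.toReal := by
    rcases eq_or_ne p ⊤ with rfl | hpt
    · simp
    · have : 1 ≤ p.toReal := by
        simpa using ENNReal.toReal_mono hpt hp1
      simpa using inv_le_one_of_one_le₀ this
  have hMt : M < ⊤ := ENNReal.rpow_lt_top_of_nonneg hexp (isCompact_cube d).measure_lt_top.ne
  -- The summand `1` pays for the variation term of the `BV` norm.
  refine ⟨(C * M).toReal + 1, by positivity, fun u => ?_⟩
  rw [BV.norm_def, add_mul, one_mul, ← ENNReal.toReal_mul, Lp.norm_def]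
  gcongr
  · exact ENNReal.mul_ne_top (ENNReal.mul_ne_top (by simp) hMt.ne) u.variation_lt_top.ne
  · have h1 : eLpNorm u 1 volume = eLpNorm u 1 (volume.restrict (cube d)) := by
      rw [eLpNorm_congr_ae u.ae_eq_indicator,
        eLpNorm_indicator_eq_eLpNorm_restrict (measurableSet_cube d)]
    calc eLpNorm u 1 volume = eLpNorm u 1 (volume.restrict (cube d)) := h1
      _ ≤ eLpNorm u p (volume.restrict (cube d)) * M := by
        have := eLpNorm_le_eLpNorm_mul_rpow_measure_univ hp1
          (u.integrable.1.mono_measure (Measure.restrict_le_self (s := cube d)))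
        rwa [Measure.restrict_apply_univ] at this
      _ ≤ (C * variation u) * M := by
        gcongr
        exact (eLpNorm_mono_measure _ Measure.restrict_le_self).trans (h u)
      _ = C * M * variation u := by ring

/-! ### The charges `T_f` -/

/-- The operator `T : L^d([0,1]^d) → BV([0,1]^d)^*`. -/
theorem exists_chargeOperator (hd : 1 ≤ d) [Fact (1 ≤ (d : ℝ≥0∞))] :
    ∃ T : Lp ℝ d (volume.restrict (cube d)) →L[ℝ] StrongDual ℝ (BV d),
      ∀ f : Lp ℝ d (volume.restrict (cube d)), Represents f (T f) := by
  obtain ⟨p, C, hp, h⟩ := BV.exists_eLpNorm_le_variation hd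
  have hmem : ∀ u : BV d, MemLp u p (volume.restrict (cube d)) := fun u =>
    ⟨u.integrable.1.restrict, (eLpNorm_mono_measure _ Measure.restrict_le_self).trans_lt
      ((h u).trans_lt (ENNReal.mul_lt_top (by simp) u.variation_lt_top))⟩
  have hint : ∀ (f : Lp ℝ d (volume.restrict (cube d))) (u : BV d),
      Integrable (fun x => f x * u x) (volume.restrict (cube d)) := fun f u =>
    (Lp.memLp f).integrable_mul (hmem u)
  have hadd : ∀ u w : BV d, ∀ᵐ x ∂(volume.restrict (cube d)), (u + w : BV d) x = u x + w x :=
    fun u w => ae_restrict_of_ae (by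
      rw [map_add]
      exact Lp.coeFn_add (BV.toL1 u) (BV.toL1 w))
  have hsmul : ∀ (c : ℝ) (u : BV d), ∀ᵐ x ∂(volume.restrict (cube d)),
      (c • u : BV d) x = c * u x :=
    fun c u => ae_restrict_of_ae (by
      rw [map_smul]
      exact Lp.coeFn_smul c (BV.toL1 u))
  let B : Lp ℝ d (volume.restrict (cube d)) →ₗ[ℝ] BV d →ₗ[ℝ] ℝ :=
    LinearMap.mk₂ ℝ (fun f u => ∫ x in cube d, f x * u x)
      (fun f g u => by
        rw [← integral_add (hint f u) (hint g u)]
        refine integral_congr_ae ?_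
        filter_upwards [Lp.coeFn_add f g] with x hx
        rw [hx, Pi.add_apply, add_mul])
      (fun c f u => by
        rw [smul_eq_mul, ← integral_const_mul]
        refine integral_congr_ae ?_
        filter_upwards [Lp.coeFn_smul c f] with x hx
        rw [hx, Pi.smul_apply, smul_eq_mul, mul_assoc])
      (fun f u w => by
        rw [← integral_add (hint f u) (hint f w)]
        refine integral_congr_ae ?_
        filter_upwards [hadd u w] with x hx
        rw [hx, mul_add])
      (fun c f u => by
        rw [smul_eq_mul, ← integral_const_mul]
        refine integral_congr_ae ?_
        filter_upwards [hsmul c u] with x hx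
        rw [hx]
        ring)
  refine ⟨B.mkContinuous₂ C fun f u => ?_, fun f u => ⟨hint f u, rfl⟩⟩
  -- Hölder with the exponents `d` and `p`, then the Sobolev bound for `u`.
  have h1 : ‖∫ x in cube d, f x * u x‖ₑ
      ≤ eLpNorm f d (volume.restrict (cube d)) * (C * variation u) := by
    refine (enorm_integral_le_lintegral_enorm _).trans ?_
    rw [← eLpNorm_one_eq_lintegral_enorm]
    refine (eLpNorm_smul_le_mul_eLpNorm (p := d) (q := p) (r := 1) (hmem u).1
      (Lp.memLp f).1).trans ?_
    gcongr
    exact (eLpNorm_mono_measure _ Measure.restrict_le_self).trans (h u)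
  have h2 := ENNReal.toReal_mono (ENNReal.mul_ne_top (Lp.eLpNorm_ne_top f)
    (ENNReal.mul_ne_top (by simp) u.variation_lt_top.ne)) h1
  rw [toReal_enorm, ENNReal.toReal_mul, ENNReal.toReal_mul, ← Lp.norm_def,
    ENNReal.coe_toReal] at h2
  refine h2.trans ?_
  rw [← mul_assoc, mul_comm ‖f‖]
  gcongr
  exact u.toReal_variation_le_norm

lemma Represents.congr {f g : Euc d → ℝ} {α : StrongDual ℝ (BV d)} (hα : Represents f α)
    (hfg : f =ᵐ[volume.restrict (cube d)] g) : Represents g α := fun u => by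
  have h : (fun x => f x * u x) =ᵐ[volume.restrict (cube d)] fun x => g x * u x :=
    hfg.mono fun x hx => congrArg (· * u x) hx
  exact ⟨(hα u).1.congr h, (hα u).2.trans (integral_congr_ae h)⟩

lemma Represents.unique {f : Euc d → ℝ} {α β : StrongDual ℝ (BV d)} (hα : Represents f α)
    (hβ : Represents f β) : α = β := by
  ext u
  rw [(hα u).2, (hβ u).2]

/-! ### Vector measures with values in Euclidean space -/

section VectorMeasure

variable {X : Type*} {mX : MeasurableSpace X}

/-- A vector measure with values in a Euclidean space has finite variation. -/
instance isFiniteMeasure_variation (μ : VectorMeasure X (Euc d)) :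
    IsFiniteMeasure μ.variation := by
  let σ : Fin d → SignedMeasure X := fun i =>
    μ.mapRange (EuclideanSpace.proj (𝕜 := ℝ) i).toLinearMap.toAddMonoidHom
      (EuclideanSpace.proj (𝕜 := ℝ) i).continuous
  have hσ : ∀ i s, σ i s = μ s i := fun i s => rfl
  have hfin : ∀ i, IsFiniteMeasure (σ i).variation := fun i => by
    rw [← SignedMeasure.totalVariation_eq_variation]
    infer_instance
  have hle : μ.variation ≤ ∑ i, (σ i).variation := by
    refine VectorMeasure.variation_le_of_forall_enorm_le fun s _ => ?_
    rw [Measure.finsetSum_apply]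
    calc ‖μ s‖ₑ = ‖∑ i, EuclideanSpace.single i (μ s i)‖ₑ := by
          congr 1
          ext j
          simp [Finset.sum_apply, Pi.single_apply]
      _ ≤ ∑ i, ‖EuclideanSpace.single i (μ s i)‖ₑ := enorm_sum_le _ _
      _ ≤ ∑ i, (σ i).variation s := by
          refine Finset.sum_le_sum fun i _ => ?_
          have : ‖EuclideanSpace.single i (μ s i)‖ₑ = ‖σ i s‖ₑ := by
            rw [hσ, enorm_eq_iff_norm_eq, PiLp.norm_single]
          rw [this]
          exact VectorMeasure.enorm_measure_le_variation _ _
  exact isFiniteMeasure_of_le _ hle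

/-- The vector measure `σ e` attached to a signed measure `σ` and a vector `e`. -/
def vecSmul (σ : SignedMeasure X) (e : Euc d) : VectorMeasure X (Euc d) :=
  σ.mapRange ((1 : ℝ →L[ℝ] ℝ).smulRight e).toLinearMap.toAddMonoidHom
    ((1 : ℝ →L[ℝ] ℝ).smulRight e).continuous

lemma integral_vecSmul (ρ : Measure X) [IsFiniteMeasure ρ] (e : Euc d) {f : X → Euc d}
    (hf : Integrable f ρ) (hf' : (vecSmul ρ.toSignedMeasure e).Integrable f) :
    (vecSmul ρ.toSignedMeasure e).integral f (dotCLM d) = ∫ x, inner ℝ e (f x) ∂ρ := by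
  have hσ : ρ.toSignedMeasure.Integrable f := by
    rwa [VectorMeasure.Integrable, Measure.variation_toSignedMeasure]
  -- `B x t = t ⟨e, x⟩`: moving the vector `e` from the measure into the pairing leaves an integral
  -- against the scalar measure.
  let B : Euc d →L[ℝ] ℝ →L[ℝ] ℝ := (lsmul ℝ ℝ).flip ∘L (innerSL ℝ e)
  have hT : (vecSmul ρ.toSignedMeasure e).transpose (dotCLM d)
      = ρ.toSignedMeasure.transpose B := by
    ext s _ x
    change inner ℝ x (ρ.toSignedMeasure s • e) = ρ.toSignedMeasure s • inner ℝ e x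
    rw [inner_smul_right, real_inner_comm, smul_eq_mul]
  have h1 : (vecSmul ρ.toSignedMeasure e).integral f (dotCLM d)
      = ρ.toSignedMeasure.integral f B := by
    rw [VectorMeasure.integral_eq_setToFun_transpose hf',
      VectorMeasure.integral_eq_setToFun_transpose hσ]
    simp only [hT]
  rw [h1, ← VectorMeasure.integral_toSignedMeasure]
  exact (VectorMeasure.integral_continuousLinearMap_comp hσ).symm

end VectorMeasure

/-! ### Existence of the gradient measure -/

/-- The finite measure with density `h⁺`. -/
def posPartMeasure (h : Euc d → ℝ) (hi : Integrable h) : FiniteMeasure (Euc d) :=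
  ⟨volume.withDensity fun x => ENNReal.ofReal (h x), isFiniteMeasure_withDensity_ofReal hi.2⟩

lemma integral_posPartMeasure {h : Euc d → ℝ} (hh : Continuous h) (hi : Integrable h)
    (g : Euc d → ℝ) : ∫ x, g x ∂(posPartMeasure h hi : Measure (Euc d))
      = ∫ x, max (h x) 0 * g x := by
  have h1 : (posPartMeasure h hi : Measure (Euc d))
      = volume.withDensity fun x => ((h x).toNNReal : ℝ≥0∞) := rfl
  rw [h1, integral_withDensity_eq_integral_smul hh.measurable.real_toNNReal]
  simp [NNReal.smul_def]

lemma mass_posPartMeasure_le {h : Euc d → ℝ} (hi : Integrable h) :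
    ((posPartMeasure h hi).mass : ℝ) ≤ ∫ x, |h x| := by
  have h1 : (posPartMeasure h hi : Measure (Euc d)) univ ≤ ∫⁻ x, ‖h x‖ₑ := by
    change volume.withDensity _ univ ≤ _
    rw [withDensity_apply _ .univ, setLIntegral_univ]
    exact lintegral_mono fun x => Real.ofReal_le_enorm _
  rw [← ofReal_integral_norm_eq_lintegral_enorm hi] at h1
  exact ENNReal.toReal_le_of_le_ofReal (by positivity) h1

lemma posPartMeasure_compl {h : Euc d → ℝ} (hi : Integrable h) {K : Set (Euc d)}
    (hK : MeasurableSet K) (h0 : ∀ x ∉ K, h x = 0) : posPartMeasure h hi Kᶜ = 0 := by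
  rw [FiniteMeasure.null_iff_toMeasure_null]
  change volume.withDensity _ Kᶜ = 0
  rw [withDensity_apply _ hK.compl]
  refine (setLIntegral_congr_fun hK.compl fun x hx => ?_).trans (lintegral_zero)
  simp [h0 x hx]

/-- Along an ultrafilter, the positive parts of a bounded family of densities supported in a fixed
compact set converge weakly to a finite measure. -/
lemma exists_tendsto_posPartMeasure {K : Set (Euc d)} (hK : IsCompact K) (U : Ultrafilter ℕ)
    {h : ℕ → Euc d → ℝ} (hi : ∀ n, Integrable (h n)) (h0 : ∀ n, ∀ x ∉ K, h n x = 0) {M : ℝ}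
    (hM : ∀ n, ∫ x, |h n x| ≤ M) :
    ∃ μ : FiniteMeasure (Euc d), Tendsto (fun n => posPartMeasure (h n) (hi n)) U (𝓝 μ) := by
  -- Prokhorov: bounded mass on a fixed compact set gives weak compactness, so an ultrafilter
  -- converges.
  have hc := isCompact_setOfPred_finiteMeasure_le_of_isCompact M.toNNReal hK
  have hU : (U.map fun n => posPartMeasure (h n) (hi n) : Filter (FiniteMeasure (Euc d)))
      ≤ 𝓟 {μ : FiniteMeasure (Euc d) | μ.mass ≤ M.toNNReal ∧ μ Kᶜ = 0} := by
    rw [le_principal_iff]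
    refine Ultrafilter.mem_map.2 (univ_mem' fun n => ⟨?_, ?_⟩)
    · exact NNReal.le_toNNReal_of_coe_le ((mass_posPartMeasure_le (hi n)).trans (hM n))
    · exact posPartMeasure_compl (hi n) hK.measurableSet (h0 n)
  obtain ⟨μ, -, hμ⟩ := hc.ultrafilter_le_nhds _ hU
  exact ⟨μ, hμ⟩

lemma IsTestField.bounded_component {v : Euc d → Euc d} (hv : IsTestField v) (i : Fin d) :
    ∃ g : BoundedContinuousFunction (Euc d) ℝ, ∀ x, g x = v x i := by
  obtain ⟨C, hC⟩ := hv.2.exists_bound_of_continuous hv.1.continuous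
  refine ⟨BoundedContinuousFunction.ofNormedAddCommGroup (fun x => v x i)
    (by have := hv.1.continuous; fun_prop) C fun x => (PiLp.norm_apply_le _ i).trans (hC x),
    fun x => rfl⟩

lemma IsTestField.component {v : Euc d → Euc d} (hv : IsTestField v) (i : Fin d) :
    ContDiff ℝ 1 fun x => v x i :=
  (EuclideanSpace.proj (𝕜 := ℝ) i).contDiff.comp hv.1

lemma IsTestField.integrable_mul_component {v : Euc d → Euc d} (hv : IsTestField v)
    {h : Euc d → ℝ} (hh : Continuous h) (i : Fin d) : Integrable fun x => h x * v x i := by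
  have h1 := (hv.component i).continuous
  refine Continuous.integrable_of_hasCompactSupport (hh.mul h1) (HasCompactSupport.mul_left ?_)
  exact hv.2.comp_left (g := fun y : Euc d => y i) rfl

lemma integral_mul_divergence_eq_sum {w : Euc d → ℝ} (hw : ContDiff ℝ 1 w)
    (hwc : HasCompactSupport w) {v : Euc d → Euc d} (hv : IsTestField v) :
    ∫ x, w x * divergence v x = -∑ i, ∫ x, partialDeriv i w x * v x i := by
  simp_rw [divergence_eq_sum_partialDeriv (hv.1.differentiable one_ne_zero), Finset.mul_sum]
  rw [integral_finsetSum, ← Finset.sum_neg_distrib]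
  · exact Finset.sum_congr rfl fun i _ => integral_mul_partialDeriv hw (hv.component i) hwc i
  · intro i _
    have h1 := hw.continuous
    have h2 := (hv.component i).continuous_fderiv one_ne_zero
    exact Continuous.integrable_of_hasCompactSupport (by unfold partialDeriv; fun_prop)
      hwc.mul_right

/-- Functions of bounded variation have a gradient measure. -/
theorem BV.exists_isGradient (u : BV d) : ∃ μ, IsGradient (u : Euc d → ℝ) μ := by
  set f : Euc d → ℝ := (cube d).indicator u with hf
  have hfi : Integrable f := u.integrable_indicator
  have hV : variation f < ⊤ := u.variation_indicator ▸ u.variation_lt_top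
  set w : ℕ → Euc d → ℝ := fun n => mollify (bump d n) f with hwdef
  have hw : ∀ n, ContDiff ℝ ∞ (w n) := fun n => contDiff_mollify _ hfi
  have hwc : ∀ n, HasCompactSupport (w n) := hasCompactSupport_mollify u.indicator_eq_zero
  have hwV : ∀ n, variation (w n) ≤ variation f := fun n => variation_mollify_le _ hfi
  have hcont : ∀ i n, Continuous (partialDeriv i (w n)) := fun i n =>
    (contDiff_partialDeriv (hw n) i).continuous
  have hint : ∀ i n, Integrable (partialDeriv i (w n)) := fun i n =>
    (hcont i n).integrable_of_hasCompactSupport (hasCompactSupport_partialDeriv (hwc n) i)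
  have hM : ∀ i n, ∫ x, |partialDeriv i (w n) x| ≤ (variation f).toReal := fun i n =>
    (integral_abs_partialDeriv_le (hw n) (hwc n) ((hwV n).trans_lt hV) i).trans
      (ENNReal.toReal_mono hV.ne (hwV n))
  have h0 : ∀ i n, ∀ x ∉ bigCube d, partialDeriv i (w n) x = 0 := fun i n x hx => by
    have h1 : x ∉ tsupport (fderiv ℝ (w n)) := fun h =>
      hx (tsupport_mollify_subset u.indicator_eq_zero n (tsupport_fderiv_subset ℝ h))
    simp [partialDeriv, image_eq_zero_of_notMem_tsupport h1]
  -- A single ultrafilter makes the `2d` families of positive and negative parts converge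
  -- simultaneously, without successive extraction of subsequences.
  let U : Ultrafilter ℕ := hyperfilter ℕ
  have hU : (U : Filter ℕ) ≤ atTop := Nat.hyperfilter_le_atTop
  choose P hP using fun i => exists_tendsto_posPartMeasure (isCompact_bigCube d) U (hint i)
    (h0 i) (hM i)
  choose Q hQ using fun i => exists_tendsto_posPartMeasure (isCompact_bigCube d) U
    (fun n => (hint i n).neg) (fun n x hx => by simp [h0 i n x hx])
    (fun n => by simpa using hM i n)
  let e : Fin d → Euc d := fun i => EuclideanSpace.single i 1
  -- `P i` and `Q i` are the weak limits of the positive and negative parts of `∂ᵢ wₙ`, so `P i - Q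
  -- i` is the `i`-th component of `Du`.
  refine ⟨∑ i, (vecSmul (P i : Measure (Euc d)).toSignedMeasure (e i)
    - vecSmul (Q i : Measure (Euc d)).toSignedMeasure (e i)), fun v hv => ?_⟩
  have hvint : ∀ (ρ : Measure (Euc d)) [IsFiniteMeasure ρ], Integrable v ρ := fun ρ _ =>
    hv.1.continuous.integrable_of_hasCompactSupport hv.2
  have hright : (∑ i, (vecSmul (P i : Measure (Euc d)).toSignedMeasure (e i)
      - vecSmul (Q i : Measure (Euc d)).toSignedMeasure (e i))).integral v (dotCLM d)
      = ∑ i, (∫ x, v x i ∂(P i : Measure (Euc d)) - ∫ x, v x i ∂(Q i : Measure (Euc d))) := by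
    rw [VectorMeasure.integral_finsetSum_vectorMeasure fun i _ => hvint _]
    refine Finset.sum_congr rfl fun i _ => ?_
    rw [VectorMeasure.integral_sub_vectorMeasure (hvint _) (hvint _),
      integral_vecSmul _ _ (hvint _) (hvint _), integral_vecSmul _ _ (hvint _) (hvint _)]
    simp [e, EuclideanSpace.inner_single_left]
  have hleft : ∫ x, u x * divergence v x = ∫ x, f x * divergence v x :=
    integral_congr_ae (u.ae_eq_indicator.mono fun x hx => congrArg (· * divergence v x) hx)
  obtain ⟨C, hC⟩ := hv.exists_bound_divergence
  have hlim1 : Tendsto (fun n => ∫ x, w n x * divergence v x) U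
      (𝓝 (∫ x, f x * divergence v x)) :=
    (tendsto_integral_mollify_mul (tendsto_rOut_bump d) hfi hv.continuous_divergence hC).mono_left
      hU
  have hlim2 : Tendsto (fun n => ∫ x, w n x * divergence v x) U
      (𝓝 (-∑ i, (∫ x, v x i ∂(P i : Measure (Euc d))
        - ∫ x, v x i ∂(Q i : Measure (Euc d))))) := by
    simp_rw [fun n => integral_mul_divergence_eq_sum ((hw n).of_le (by simp)) (hwc n) hv]
    refine (tendsto_finsetSum _ fun i _ => ?_).neg
    obtain ⟨g, hg⟩ := hv.bounded_component i
    have h1 := (FiniteMeasure.tendsto_iff_forall_integral_tendsto.1 (hP i) g).sub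
      (FiniteMeasure.tendsto_iff_forall_integral_tendsto.1 (hQ i) g)
    simp_rw [hg] at h1
    refine h1.congr fun n => ?_
    rw [integral_posPartMeasure (hcont i n), integral_posPartMeasure (hcont i n).neg,
      ← integral_sub]
    · congr 1 with x
      rw [← sub_mul]
      congr 1
      rcases le_total 0 (partialDeriv i (w n) x) with h | h <;> simp [h]
    · exact hv.integrable_mul_component ((hcont i n).max continuous_const) i
    · exact hv.integrable_mul_component ((hcont i n).neg.max continuous_const) i
  rw [hleft, hright]
  exact tendsto_nhds_unique hlim1 hlim2

theorem BV.isGradient_grad (u : BV d) : IsGradient (u : Euc d → ℝ) u.grad := by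
  rw [BV.grad, dif_pos u.exists_isGradient]
  exact u.exists_isGradient.choose_spec

/-! ### The gradient paired over the closed cube -/

/-- Being `1` on a neighbourhood of the cube, and not merely on it, keeps the divergence of `χ • w`
equal to that of `w` at every point of the cube. -/
lemma exists_cutoff (d : ℕ) {δ : ℝ} (hδ : 0 < δ) :
    ∃ χ : Euc d → ℝ, ContDiff ℝ 1 χ ∧ (∀ᶠ x in 𝓝ˢ (cube d), χ x = 1) ∧
      (∀ x ∉ Metric.thickening δ (cube d), χ x = 0) ∧ ∀ x, χ x ∈ Icc (0 : ℝ) 1 := by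
  obtain ⟨f, h1, h2, h3⟩ := exists_contMDiffMap_one_nhds_of_subset_interior (n := 1)
    𝓘(ℝ, Euc d) (isClosed_cube d) (t := Metric.thickening δ (cube d))
    (by rw [Metric.isOpen_thickening.interior_eq]; exact Metric.self_subset_thickening hδ _)
  exact ⟨f, contMDiff_iff_contDiff.1 f.contMDiff, h1, h2, h3⟩

lemma hasCompactSupport_of_thickening {δ : ℝ} {E : Type*} [Zero E] {χ : Euc d → E}
    (h : ∀ x ∉ Metric.thickening δ (cube d), χ x = 0) : HasCompactSupport χ :=
  .intro (isCompact_cube d).cthickening fun x hx =>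
    h x fun h' => hx (Metric.thickening_subset_cthickening _ _ h')

lemma exists_seq_cutoff (d : ℕ) :
    ∃ χ : ℕ → Euc d → ℝ, (∀ n, ContDiff ℝ 1 (χ n)) ∧ (∀ n, ∀ᶠ x in 𝓝ˢ (cube d), χ n x = 1) ∧
      (∀ n x, χ n x ∈ Icc (0 : ℝ) 1) ∧
      ∀ x, Tendsto (fun n => χ n x) atTop (𝓝 ((cube d).indicator 1 x)) := by
  choose χ hχ h1 h0 hI using fun n : ℕ => exists_cutoff d (δ := 1 / ((n : ℝ) + 1)) (by positivity)
  refine ⟨χ, hχ, h1, hI, fun x => ?_⟩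
  by_cases hx : x ∈ cube d
  · have : ∀ n, χ n x = 1 := fun n => (h1 n).self_of_nhdsSet x hx
    simp [hx, this]
  · have h2 : ∀ᶠ δ in 𝓝 (0 : ℝ), x ∉ Metric.thickening δ (cube d) :=
      Metric.eventually_notMem_thickening_of_infEDist_pos (by
        rwa [(isClosed_cube d).closure_eq])
    refine tendsto_const_nhds.congr' ?_
    filter_upwards [tendsto_one_div_add_atTop_nhds_zero_nat.eventually h2] with n hn
    simp [hx, h0 n x hn]

lemma norm_smul_le_of_mem_Icc {a : ℝ} (ha : a ∈ Icc (0 : ℝ) 1) (x : Euc d) : ‖a • x‖ ≤ ‖x‖ := by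
  rw [norm_smul, Real.norm_of_nonneg ha.1]
  exact mul_le_of_le_one_left (norm_nonneg _) ha.2

lemma divergence_congr {v w : Euc d → Euc d} {x : Euc d} (h : v =ᶠ[𝓝 x] w) :
    divergence v x = divergence w x := by
  simp only [divergence, h.fderiv_eq]

lemma BV.integral_mul_divergence_congr (u : BV d) {v w : Euc d → Euc d}
    (h : ∀ᶠ x in 𝓝ˢ (cube d), v x = w x) :
    ∫ x, u x * divergence v x = ∫ x, u x * divergence w x := by
  refine integral_congr_ae ?_
  filter_upwards [u.2.1] with x hx
  by_cases hc : x ∈ cube d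
  · have : divergence v x = divergence w x := divergence_congr (h.filter_mono (nhds_le_nhdsSet hc))
    simp only [this]
  · have : u x = 0 := hx hc
    simp [this]

lemma BV.integral_grad_cutoff (u : BV d) {w : Euc d → Euc d} (hw : IsTestField w) {χ : Euc d → ℝ}
    (hχ : ContDiff ℝ 1 χ) (h1 : ∀ᶠ x in 𝓝ˢ (cube d), χ x = 1) :
    u.grad.integral (fun x => χ x • w x) (dotCLM d) = -∫ x, u x * divergence w x := by
  have htest : IsTestField fun x => χ x • w x :=
    ⟨hχ.smul hw.1, HasCompactSupport.smul_left (f := χ) (f' := w) hw.2⟩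
  have h := u.isGradient_grad _ htest
  rw [u.integral_mul_divergence_congr (w := w)] at h
  · rw [h, neg_neg]
  · filter_upwards [h1] with x hx
    rw [hx, one_smul]

/-- The cutoffs shrink to the indicator of the closed cube while the pairing with `χ n • w` does not
depend on `n`; dominated convergence identifies the limit. Any part of `Du` on the boundary is kept.
-/
lemma BV.integral_grad_indicator (u : BV d) {w : Euc d → Euc d} (hw : IsTestField w) :
    u.grad.integral ((cube d).indicator w) (dotCLM d) = -∫ x, u x * divergence w x := by
  obtain ⟨χ, hχ, h1, hI, hχlim⟩ := exists_seq_cutoff d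
  obtain ⟨C, hC⟩ := hw.2.exists_bound_of_continuous hw.1.continuous
  have hlim : Tendsto (fun n => u.grad.integral (fun x => χ n x • w x) (dotCLM d)) atTop
      (𝓝 (u.grad.integral ((cube d).indicator w) (dotCLM d))) := by
    refine VectorMeasure.tendsto_integral_filter_of_norm_le_const
      (.of_forall fun n => ((hχ n).continuous.smul hw.1.continuous).aestronglyMeasurable)
      ⟨C, .of_forall fun n => .of_forall fun x => ?_⟩ (.of_forall fun x => ?_)
    · exact (norm_smul_le_of_mem_Icc (hI n x) _).trans (hC x)
    · have h2 := (hχlim x).smul_const (w x)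
      by_cases hx : x ∈ cube d <;> simpa [hx] using h2
  refine tendsto_nhds_unique hlim (tendsto_const_nhds.congr fun n => ?_)
  exact (u.integral_grad_cutoff hw (hχ n) (h1 n)).symm

/-- For test fields, the pairing with the part of the gradient inside the closed cube is given by
the divergence. -/
theorem fracDiv_eq_integral {v : C(cube d, Euc d)} {w : Euc d → Euc d} (hw : IsTestField w)
    (h : ∀ x : cube d, v x = w x) (u : BV d) :
    fracDiv v u = ∫ x, u x * divergence w x := by
  have hext : EqOn (Function.extend Subtype.val v 0) w (cube d) := fun x hx => by
    rw [← h ⟨x, hx⟩]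
    exact Subtype.val_injective.extend_apply v 0 ⟨x, hx⟩
  rw [fracDiv, VectorMeasure.setIntegral_congr_fun hext,
    ← VectorMeasure.integral_indicator (measurableSet_cube d), u.integral_grad_indicator hw,
    neg_neg]

/-! ### The operator `𝔡𝔦𝔳` and its range in `SCH` -/

instance compactSpace_cube (d : ℕ) : CompactSpace (cube d) :=
  isCompact_iff_compactSpace.1 (isCompact_cube d)

lemma norm_extend_le (v : C(cube d, Euc d)) (x : Euc d) :
    ‖Function.extend Subtype.val v 0 x‖ ≤ ‖v‖ := by
  by_cases hx : x ∈ cube d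
  · have := Subtype.val_injective.extend_apply v 0 (⟨x, hx⟩ : cube d)
    rw [this]
    exact v.norm_coe_le_norm _
  · rw [Function.extend_apply']
    · simp
    · rintro ⟨y, rfl⟩
      exact hx y.2

lemma integrable_extend (v : C(cube d, Euc d)) (μ : VectorMeasure (Euc d) (Euc d)) :
    μ.Integrable (Function.extend Subtype.val v 0) := by
  have hm : Measurable (Function.extend Subtype.val v 0) :=
    (MeasurableEmbedding.subtype_coe (measurableSet_cube d)).measurable_extend
      v.continuous.measurable measurable_zero
  exact Integrable.of_bound hm.aestronglyMeasurable ‖v‖ (.of_forall (norm_extend_le v))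

lemma fracDiv_add (v w : C(cube d, Euc d)) (u : BV d) :
    fracDiv (v + w) u = fracDiv v u + fracDiv w u := by
  have h : Function.extend Subtype.val (v + w) 0
      = Function.extend Subtype.val v 0 + Function.extend Subtype.val w 0 := by
    rw [ContinuousMap.coe_add, ← Function.extend_add, add_zero]
  rw [fracDiv, ContinuousMap.coe_add, ← ContinuousMap.coe_add, h,
    VectorMeasure.integral_add (integrable_extend v _) (integrable_extend w _), neg_add]
  rfl

lemma fracDiv_smul (c : ℝ) (v : C(cube d, Euc d)) (u : BV d) :
    fracDiv (c • v) u = c * fracDiv v u := by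
  have h : Function.extend Subtype.val (c • v) 0 = c • Function.extend Subtype.val v 0 := by
    rw [ContinuousMap.coe_smul, ← Function.extend_smul, smul_zero]
  rw [fracDiv, h, VectorMeasure.integral_smul, smul_eq_mul, fracDiv, mul_neg]

lemma fracDiv_sub (v w : C(cube d, Euc d)) (u : BV d) :
    fracDiv (v - w) u = fracDiv v u - fracDiv w u := by
  have := fracDiv_add (v - w) w u
  rw [sub_add_cancel] at this
  linarith

/-- A crude constant depending on `u`, used only for continuity in `v`. The bound by the `BV` norm
is obtained afterwards by approximation with test fields. -/
lemma exists_abs_fracDiv_le (u : BV d) :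
    ∃ M : ℝ, ∀ v : C(cube d, Euc d), |fracDiv v u| ≤ ‖v‖ * M := by
  refine ⟨‖dotCLM d‖ * (u.grad.restrict (cube d)).variation.real univ, fun v => ?_⟩
  rw [fracDiv, abs_neg, ← mul_assoc]
  exact VectorMeasure.norm_integral_le_of_norm_le_const (μ := u.grad.restrict (cube d))
    (B := dotCLM d) (.of_forall (norm_extend_le v))

/-- The coordinatewise projection of `ℝ^d` onto the unit cube. -/
def clamp (x : Euc d) : cube d :=
  ⟨WithLp.toLp 2 fun i => (projIcc (0 : ℝ) 1 zero_le_one (x i) : ℝ), fun i =>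
    (projIcc (0 : ℝ) 1 zero_le_one (x i)).2⟩

lemma uniformContinuous_clamp : UniformContinuous (clamp : Euc d → cube d) := by
  refine UniformContinuous.subtype_mk ?_ _
  refine (PiLp.uniformContinuous_toLp 2 _).comp (uniformContinuous_pi.2 fun i => ?_)
  exact uniformContinuous_subtype_val.comp
    ((LipschitzWith.projIcc zero_le_one).uniformContinuous.comp
      (EuclideanSpace.proj (𝕜 := ℝ) i).uniformContinuous)

lemma clamp_coe (x : cube d) : clamp (x : Euc d) = x := by
  refine Subtype.ext ?_
  ext i
  simp [clamp, projIcc_of_mem _ (x.2 i)]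

/-- Continuous fields on the cube are uniformly approximated by test fields. -/
lemma exists_testField_approx (v : C(cube d, Euc d)) {ε : ℝ} (hε : 0 < ε) :
    ∃ w : Euc d → Euc d, IsTestField w ∧ (∀ x, ‖w x‖ ≤ ‖v‖ + ε) ∧
      ∀ x : cube d, ‖w x - v x‖ ≤ ε := by
  -- `v ∘ clamp` extends `v` to a uniformly continuous field on `ℝ^d` without enlarging its norm. It
  -- therefore has uniform smooth approximations, and the cutoff does not alter them on the cube.
  have huc : UniformContinuous (v ∘ clamp : Euc d → Euc d) :=
    (CompactSpace.uniformContinuous_of_continuous v.continuous).comp uniformContinuous_clamp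
  obtain ⟨g, hg, hgv⟩ := huc.exists_contDiff_dist_le hε
  obtain ⟨χ, hχ, h1, h0, hI⟩ := exists_cutoff d zero_lt_one
  refine ⟨fun x => χ x • g x, ⟨hχ.smul (hg.of_le (by simp)), ?_⟩, fun x => ?_, fun x => ?_⟩
  · exact hasCompactSupport_of_thickening (δ := 1) fun x hx => by simp [h0 x hx]
  · refine (norm_smul_le_of_mem_Icc (hI x) _).trans ?_
    calc ‖g x‖ ≤ ‖v (clamp x)‖ + ‖g x - v (clamp x)‖ := norm_le_insert' _ _
      _ ≤ ‖v‖ + ε := add_le_add (v.norm_coe_le_norm _) (by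
        rw [← dist_eq_norm]
        exact (hgv x).le)
  · have h2 := (hgv x).le
    rw [Function.comp_apply, clamp_coe, dist_eq_norm] at h2
    simpa [h1.self_of_nhdsSet x x.2] using h2

/-- The restriction of a continuous field to the cube. -/
def restrictCube {w : Euc d → Euc d} (hw : Continuous w) : C(cube d, Euc d) :=
  ⟨fun x => w x, hw.comp continuous_subtype_val⟩

lemma fracDiv_restrictCube {w : Euc d → Euc d} (hw : IsTestField w) (u : BV d) :
    fracDiv (restrictCube hw.1.continuous) u = ∫ x, u x * divergence w x :=
  fracDiv_eq_integral hw (fun _ => rfl) u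

lemma exists_seq_testField (v : C(cube d, Euc d)) :
    ∃ w : ℕ → Euc d → Euc d, ∃ hw : ∀ n, IsTestField (w n),
      (∀ n x, ‖w n x‖ ≤ ‖v‖ + 1 / ((n : ℝ) + 1)) ∧
      (∀ n, ‖restrictCube (hw n).1.continuous - v‖ ≤ 1 / ((n : ℝ) + 1)) ∧
      ∀ u : BV d, Tendsto (fun n => ∫ x, u x * divergence (w n) x) atTop (𝓝 (fracDiv v u)) := by
  choose w hw hb ha using fun n : ℕ =>
    exists_testField_approx v (ε := 1 / ((n : ℝ) + 1)) (by positivity)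
  have ha' : ∀ n, ‖restrictCube (hw n).1.continuous - v‖ ≤ 1 / ((n : ℝ) + 1) := fun n =>
    (ContinuousMap.norm_le _ (by positivity)).2 (ha n)
  refine ⟨w, hw, hb, ha', fun u => ?_⟩
  obtain ⟨M, hM⟩ := exists_abs_fracDiv_le u
  have hM0 : ∀ n, |(∫ x, u x * divergence (w n) x) - fracDiv v u| ≤ 1 / ((n : ℝ) + 1) * |M| :=
    fun n => by
      rw [← fracDiv_restrictCube (hw n), ← fracDiv_sub]
      refine (hM _).trans ((mul_le_mul_of_nonneg_left (le_abs_self M) (norm_nonneg _)).trans ?_)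
      gcongr
      exact ha' n
  rw [tendsto_iff_dist_tendsto_zero]
  refine squeeze_zero (fun n => dist_nonneg) hM0 ?_
  simpa using (tendsto_one_div_add_atTop_nhds_zero_nat (𝕜 := ℝ)).mul_const |M|

lemma IsTestField.const_smul {w : Euc d → Euc d} (hw : IsTestField w) (r : ℝ) :
    IsTestField (r • w) :=
  ⟨hw.1.const_smul r, hw.2.smul_left (f := fun _ => r)⟩

lemma BV.integral_mul_divergence_le (u : BV d) {w : Euc d → Euc d} (hw : IsTestField w) {r : ℝ}
    (hr : 0 < r) (h : ∀ x, ‖w x‖ ≤ r) :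
    ∫ x, u x * divergence w x ≤ r * (variation u).toReal := by
  have h1 : IsTestField (r⁻¹ • w) := hw.const_smul r⁻¹
  have h2 := StrongCharge.integral_mul_divergence_le u.variation_lt_top h1 fun x => by
    rw [Pi.smul_apply, norm_smul, norm_inv, Real.norm_of_nonneg hr.le, inv_mul_le_iff₀ hr, mul_one]
    exact h x
  have h3 : ∀ x, divergence (r⁻¹ • w) x = r⁻¹ * divergence w x := fun x => by
    simp [divergence, fderiv_const_smul (hw.1.differentiable one_ne_zero x), Finset.mul_sum]
  simp_rw [h3, mul_left_comm] at h2
  rwa [integral_const_mul, inv_mul_le_iff₀ hr] at h2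

/-- For test fields this is the definition of the variation; the approximating fields have norms at
most `‖v‖ + 1 / (n + 1)`. -/
lemma fracDiv_le (v : C(cube d, Euc d)) (u : BV d) :
    fracDiv v u ≤ ‖v‖ * (variation u).toReal := by
  obtain ⟨w, hw, hb, -, hlim⟩ := exists_seq_testField v
  have h2 : Tendsto (fun n : ℕ => (‖v‖ + 1 / ((n : ℝ) + 1)) * (variation u).toReal) atTop
      (𝓝 (‖v‖ * (variation u).toReal)) := by
    simpa using ((tendsto_one_div_add_atTop_nhds_zero_nat (𝕜 := ℝ)).const_add ‖v‖).mul_const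
      (variation u).toReal
  exact le_of_tendsto_of_tendsto' (hlim u) h2 fun n =>
    u.integral_mul_divergence_le (hw n) (by positivity) (hb n)

lemma abs_fracDiv_le (v : C(cube d, Euc d)) (u : BV d) :
    |fracDiv v u| ≤ ‖v‖ * ‖u‖ := by
  have h : ∀ v : C(cube d, Euc d), fracDiv v u ≤ ‖v‖ * ‖u‖ := fun v =>
    (fracDiv_le v u).trans (mul_le_mul_of_nonneg_left u.toReal_variation_le_norm (norm_nonneg v))
  refine abs_le'.2 ⟨h v, ?_⟩
  have h2 := fracDiv_smul (-1) v u
  have h3 := h ((-1 : ℝ) • v)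
  rw [h2, norm_smul] at h3
  simpa using h3

lemma IsTestField.integral_add_mul {w : Euc d → Euc d} (hw : IsTestField w) (u u' : BV d) :
    ∫ x, (u + u' : BV d) x * divergence w x
      = (∫ x, u x * divergence w x) + ∫ x, u' x * divergence w x := by
  rw [← integral_add (hw.integrable_mul u.integrable) (hw.integrable_mul u'.integrable), map_add]
  refine integral_congr_ae ?_
  filter_upwards [Lp.coeFn_add (BV.toL1 u) (BV.toL1 u')] with x hx
  rw [hx, Pi.add_apply, add_mul]

lemma BV.integral_smul_mul (u : BV d) (c : ℝ) (w : Euc d → Euc d) :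
    ∫ x, (c • u : BV d) x * divergence w x = c * ∫ x, u x * divergence w x := by
  rw [← integral_const_mul, map_smul]
  refine integral_congr_ae ?_
  filter_upwards [Lp.coeFn_smul c (BV.toL1 u)] with x hx
  rw [hx, Pi.smul_apply, smul_eq_mul, mul_assoc]

/-- The functional `u ↦ -∫_{[0,1]^d} v · dDu` depends linearly on `v` and `u`. -/
def fracDivBilin (d : ℕ) : C(cube d, Euc d) →ₗ[ℝ] BV d →ₗ[ℝ] ℝ :=
  LinearMap.mk₂ ℝ fracDiv fracDiv_add fracDiv_smul
    -- `u.grad` is obtained by choice, so linearity in `u` is read off from the limits of `∫ u div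
    -- wₙ` instead.
    (fun v u u' => by
      obtain ⟨w, hw, -, -, hlim⟩ := exists_seq_testField v
      refine tendsto_nhds_unique (hlim (u + u')) ?_
      simp_rw [fun n => (hw n).integral_add_mul u u']
      exact (hlim u).add (hlim u'))
    (fun c v u => by
      obtain ⟨w, hw, -, -, hlim⟩ := exists_seq_testField v
      refine tendsto_nhds_unique (hlim (c • u)) ?_
      simp_rw [fun n => u.integral_smul_mul c (w n)]
      exact (hlim u).const_mul c)

/-- The operator `𝔡𝔦𝔳` with values in the dual of `BV([0,1]^d)`. -/
def fracDivOperator (d : ℕ) : C(cube d, Euc d) →L[ℝ] StrongDual ℝ (BV d) :=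
  (fracDivBilin d).mkContinuous₂ 1 fun v u => by
    rw [one_mul]
    exact abs_fracDiv_le v u

lemma fracDivOperator_apply (v : C(cube d, Euc d)) (u : BV d) :
    fracDivOperator d v u = fracDiv v u := rfl

lemma IsTestField.represents_divergence {w : Euc d → Euc d} (hw : IsTestField w) :
    Represents (divergence w) (fracDivOperator d (restrictCube hw.1.continuous)) := fun u => by
  refine ⟨?_, ?_⟩
  · simpa only [mul_comm] using (hw.integrable_mul u.integrable).integrableOn
  · rw [fracDivOperator_apply, fracDiv_restrictCube hw, u.setIntegral_mul]
    simp only [mul_comm]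

lemma IsTestField.memLp_divergence {w : Euc d → Euc d} (hw : IsTestField w) (p : ℝ≥0∞) :
    MemLp (divergence w) p (volume.restrict (cube d)) :=
  (hw.continuous_divergence.memLp_of_hasCompactSupport hw.hasCompactSupport_divergence).restrict _

/-- Test fields give charges `T_f` with `f` their divergence; density, continuity of the operator
and closedness of `SCH` do the rest. -/
lemma fracDivOperator_mem_SCH (v : C(cube d, Euc d)) : fracDivOperator d v ∈ SCH d := by
  obtain ⟨w, hw, -, ha, -⟩ := exists_seq_testField v
  have hlim : Tendsto (fun n => restrictCube (hw n).1.continuous) atTop (𝓝 v) := by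
    rw [tendsto_iff_norm_sub_tendsto_zero]
    exact squeeze_zero (fun n => norm_nonneg _) ha tendsto_one_div_add_atTop_nhds_zero_nat
  refine mem_closure_of_tendsto (((fracDivOperator d).continuous.tendsto v).comp hlim)
    (.of_forall fun n => ?_)
  exact ⟨divergence (w n), (hw n).memLp_divergence d, (hw n).represents_divergence⟩

/-! ### Densities of functionals on `L^p`, `p < ∞` -/

section LpDual

variable {X : Type*} {mX : MeasurableSpace X} {m : Measure X} [IsFiniteMeasure m] {p : ℝ≥0∞}

open Classical in
/-- The class in `L^p` of the indicator function of a measurable set. -/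
def indLp (m : Measure X) [IsFiniteMeasure m] (p : ℝ≥0∞) (A : Set X) : Lp ℝ p m :=
  if hA : MeasurableSet A then indicatorConstLp p hA (measure_ne_top m A) 1 else 0

lemma indLp_of_measurableSet {A : Set X} (hA : MeasurableSet A) :
    indLp m p A = indicatorConstLp p hA (measure_ne_top m A) 1 := dif_pos hA

lemma indLp_empty : indLp m p ∅ = 0 := by
  rw [indLp_of_measurableSet .empty, indicatorConstLp_empty]

lemma indLp_union {A B : Set X} (hA : MeasurableSet A) (hB : MeasurableSet B)
    (h : Disjoint A B) : indLp m p (A ∪ B) = indLp m p A + indLp m p B := by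
  rw [indLp_of_measurableSet hA, indLp_of_measurableSet hB, indLp_of_measurableSet (hA.union hB),
    indicatorConstLp_disjoint_union hA hB _ _ h]

lemma indLp_biUnion {f : ℕ → Set X} (hf : ∀ i, MeasurableSet (f i))
    (hd : Pairwise (Function.onFun Disjoint f)) (s : Finset ℕ) :
    indLp m p (⋃ i ∈ s, f i) = ∑ i ∈ s, indLp m p (f i) := by
  induction s using Finset.induction_on with
  | empty => simp [indLp_empty]
  | insert a s ha ih =>
    rw [Finset.set_biUnion_insert, Finset.sum_insert ha, indLp_union (hf a)
      (s.measurableSet_biUnion fun i _ => hf i), ih]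
    rw [disjoint_iUnion₂_right]
    exact fun i hi => hd fun h => ha (h ▸ hi)

/-- The remainders of the union have measure tending to `0`, hence small `L^p` norm because `p < ∞`.
This is the countable additivity of `A ↦ l(1_A)`. -/
lemma hasSum_indLp [Fact (1 ≤ p)] (hp : p ≠ ⊤) {f : ℕ → Set X} (hf : ∀ i, MeasurableSet (f i))
    (hd : Pairwise (Function.onFun Disjoint f)) :
    HasSum (fun i => indLp m p (f i)) (indLp m p (⋃ i, f i)) := by
  have hU : MeasurableSet (⋃ i, f i) := .iUnion hf
  have hs : ∀ s : Finset ℕ, MeasurableSet (⋃ i ∈ s, f i) := fun s =>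
    s.measurableSet_biUnion fun i _ => hf i
  have hsub : ∀ s : Finset ℕ, (⋃ i ∈ s, f i) ⊆ ⋃ i, f i := fun s =>
    iUnion₂_subset fun i _ => subset_iUnion f i
  rw [HasSum, SummationFilter.unconditional_filter]
  simp_rw [← indLp_biUnion hf hd]
  rw [indLp_of_measurableSet hU]
  simp_rw [fun s => indLp_of_measurableSet (m := m) (p := p) (hs s)]
  refine tendsto_indicatorConstLp_set hp ?_
  have hmono : Monotone fun s : Finset ℕ => ⋃ i ∈ s, f i := fun s t hst =>
    biUnion_subset_biUnion_left hst
  have h1 := tendsto_measure_iUnion_atTop (μ := m) hmono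
  rw [iUnion_eq_iUnion_finset f |>.symm] at h1
  have h2 := ENNReal.Tendsto.sub (tendsto_const_nhds (x := m (⋃ i, f i))) h1
    (.inl (measure_ne_top _ _))
  rw [tsub_self] at h2
  refine h2.congr fun s => ?_
  rw [Set.symmDiff_def, sdiff_eq_empty.2 (hsub s), empty_union,
    measure_sdiff (hsub s) (hs s).nullMeasurableSet (measure_ne_top _ _)]
  rfl

/-- The signed measure attached to a continuous linear functional on `L^p`. -/
def dualMeasure [Fact (1 ≤ p)] (hp : p ≠ ⊤) (l : StrongDual ℝ (Lp ℝ p m)) : SignedMeasure X where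
  measureOf' A := l (indLp m p A)
  empty' := by rw [indLp_empty, map_zero]
  not_measurable' A hA := by rw [indLp, dif_neg hA, map_zero]
  m_iUnion' f hf hd := (hasSum_indLp hp hf hd).mapL l

lemma dualMeasure_apply [Fact (1 ≤ p)] (hp : p ≠ ⊤) (l : StrongDual ℝ (Lp ℝ p m)) (A : Set X) :
    dualMeasure hp l A = l (indLp m p A) := rfl

/-- Radon–Nikodym: a null set has zero indicator in `L^p`, so the signed measure `A ↦ l(1_A)` is
absolutely continuous. -/
lemma exists_density_indLp [Fact (1 ≤ p)] (hp : p ≠ ⊤) (l : StrongDual ℝ (Lp ℝ p m)) :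
    ∃ g : X → ℝ, Integrable g m ∧
      ∀ A, MeasurableSet A → l (indLp m p A) = ∫ x in A, g x ∂m := by
  have hac : dualMeasure hp l ≪ᵥ m.toENNRealVectorMeasure := by
    refine VectorMeasure.AbsolutelyContinuous.mk fun A hA h => ?_
    rw [Measure.toENNRealVectorMeasure_apply_measurable hA] at h
    have : indLp m p A = 0 := by
      have hp0 : p ≠ 0 := (one_pos.trans_le (Fact.out : 1 ≤ p)).ne'
      have h0 : 1 / p.toReal ≠ 0 := one_div_ne_zero (ENNReal.toReal_ne_zero.2 ⟨hp0, hp⟩)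
      rw [indLp_of_measurableSet hA, ← norm_eq_zero, norm_indicatorConstLp hp0 hp, Measure.real, h,
        ENNReal.toReal_zero, Real.zero_rpow h0, mul_zero]
    rw [dualMeasure_apply, this, map_zero]
  refine ⟨(dualMeasure hp l).rnDeriv m, SignedMeasure.integrable_rnDeriv _ _, fun A hA => ?_⟩
  rw [← withDensityᵥ_apply (SignedMeasure.integrable_rnDeriv _ _) hA,
    SignedMeasure.withDensityᵥ_rnDeriv_eq _ _ hac, dualMeasure_apply]

/-- Every continuous linear functional on `L^p` of a finite measure, `p < ∞`, is given on bounded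
functions by an integrable density. -/
theorem exists_density [Fact (1 ≤ p)] (hp : p ≠ ⊤) (l : StrongDual ℝ (Lp ℝ p m)) :
    ∃ g : X → ℝ, Integrable g m ∧
      ∀ (f : X → ℝ) (hf : MemLp f p m), Measurable f → (∃ C, ∀ x, ‖f x‖ ≤ C) →
        l (hf.toLp f) = ∫ x, f x * g x ∂m := by
  obtain ⟨g, hg, hl⟩ := exists_density_indLp hp l
  have hbdd : ∀ f : X → ℝ, Measurable f → (∃ C, ∀ x, ‖f x‖ ≤ C) →
      Integrable (fun x => f x * g x) m := fun f hf ⟨C, hC⟩ =>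
    hg.bdd_mul hf.aestronglyMeasurable (.of_forall hC)
  have hsimple : ∀ (f : SimpleFunc X ℝ) (hf : MemLp f p m),
      l (hf.toLp f) = ∫ x, f x * g x ∂m := by
    intro f
    induction f using SimpleFunc.induction with
    | @const c A hA =>
      intro hf
      have h1 : hf.toLp _ = c • indLp m p A := by
        rw [indLp_of_measurableSet hA]
        ext1
        filter_upwards [hf.coeFn_toLp, Lp.coeFn_smul c (indicatorConstLp p hA
          (measure_ne_top m A) (1 : ℝ)), indicatorConstLp_coeFn (p := p) (hs := hA)
          (hμs := measure_ne_top m A) (c := (1 : ℝ))] with x h1 h2 h3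
        rw [h1, h2, Pi.smul_apply, h3]
        by_cases hx : x ∈ A <;> simp [hx]
      rw [h1, map_smul, hl A hA, smul_eq_mul, ← integral_const_mul, ← integral_indicator hA]
      congr 1 with x
      by_cases hx : x ∈ A <;> simp [hx]
    | @add f f' hd h1 h2 =>
      intro hf
      have hf1 : ∀ f : SimpleFunc X ℝ, MemLp f p m := fun f => f.memLp_of_isFiniteMeasure p m
      have h3 : hf.toLp _ = (hf1 f).toLp f + (hf1 f').toLp f' := MemLp.toLp_add _ _
      rw [h3, map_add, h1, h2, ← integral_add (hbdd f f.measurable f.exists_forall_norm_le)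
        (hbdd f' f'.measurable f'.exists_forall_norm_le)]
      simp only [SimpleFunc.coe_add, Pi.add_apply, add_mul]
  refine ⟨g, hg, fun f hf hfm ⟨C, hC⟩ => ?_⟩
  -- The same simple functions converge to `f` in `L^p`, for the left side, and pointwise with the
  -- bound `2C`, for dominated convergence on the right.
  have h1 := (l.continuous.tendsto _).comp (SimpleFunc.tendsto_approxOn_range_Lp hp hfm hf)
  refine tendsto_nhds_unique h1 ?_
  simp only [Function.comp_def, hsimple]
  refine tendsto_integral_of_dominated_convergence (fun x => (C + C) * ‖g x‖)
    (fun n => (hbdd _ (SimpleFunc.measurable _) (SimpleFunc.exists_forall_norm_le _)).1)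
    (hg.norm.const_mul _) (fun n => .of_forall fun x => ?_) (.of_forall fun x => ?_)
  · rw [norm_mul]
    gcongr
    exact (SimpleFunc.norm_approxOn_zero_le hfm _ x n).trans (add_le_add (hC x) (hC x))
  · exact (SimpleFunc.tendsto_approxOn hfm _ (subset_closure (by simp))).mul_const _

end LpDual

/-! ### Successive approximation -/

section OpenMapping

variable {E F : Type*} [NormedAddCommGroup E] [NormedSpace ℝ E] [CompleteSpace E]
  [NormedAddCommGroup F] [NormedSpace ℝ F]

/-- A continuous linear map which solves every equation approximately with control of the norm is
onto. -/
theorem surjective_of_approx_preimage (f : E →L[ℝ] F) {C : ℝ} (hC0 : 0 ≤ C)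
    (hC : ∀ y, ∃ x, ‖f x - y‖ ≤ 1 / 2 * ‖y‖ ∧ ‖x‖ ≤ C * ‖y‖) : Function.Surjective f := by
  choose g hg using hC
  -- `h y` is the residual after one correction. Residuals halve at each step, so the corrections
  -- form an absolutely convergent series in the complete space `E`.
  let h : F → F := fun y => y - f (g y)
  intro y
  have hnle : ∀ n : ℕ, ‖h^[n] y‖ ≤ (1 / 2) ^ n * ‖y‖ := by
    intro n
    induction n with
    | zero => simp
    | succ n IH =>
      rw [Function.iterate_succ_apply', pow_succ', mul_assoc, ← norm_neg, neg_sub]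
      exact (hg _).1.trans (by gcongr)
  have ule : ∀ n, ‖g (h^[n] y)‖ ≤ (1 / 2) ^ n * (C * ‖y‖) := fun n =>
    (hg _).2.trans ((mul_le_mul_of_nonneg_left (hnle n) hC0).trans (le_of_eq (by ring)))
  have su : Summable fun n => g (h^[n] y) :=
    .of_norm (.of_nonneg_of_le (fun n => norm_nonneg _) ule (summable_geometric_two.mul_right _))
  have fsumeq : ∀ n : ℕ, f (∑ i ∈ Finset.range n, g (h^[i] y)) = y - h^[n] y := by
    intro n
    induction n with
    | zero => simp
    | succ n IH => rw [Finset.sum_range_succ, map_add, IH, Function.iterate_succ_apply', sub_add]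
  refine ⟨_, tendsto_nhds_unique ((f.continuous.tendsto _).comp su.hasSum.tendsto_sum_nat) ?_⟩
  simp only [Function.comp_def, fsumeq]
  have h0 : Tendsto (fun n => h^[n] y) atTop (𝓝 0) := by
    refine squeeze_zero_norm hnle ?_
    simpa using (tendsto_pow_atTop_nhds_zero_of_lt_one (r := (1 / 2 : ℝ)) (by norm_num)
      (by norm_num)).mul_const ‖y‖
  simpa using h0.const_sub y

end OpenMapping

/-! ### Surjectivity by duality -/

lemma variation_le_of_forall {u : Euc d → ℝ} {r : ℝ}
    (h : ∀ w : Euc d → Euc d, IsTestField w → (∀ x, ‖w x‖ ≤ 1) → ∫ x, u x * divergence w x ≤ r) :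
    variation u ≤ ENNReal.ofReal r :=
  iSup_le fun w => iSup_le fun hw => iSup_le fun h1 => ENNReal.ofReal_le_ofReal (h w hw h1)

/-- A functional on the dual of `BV([0,1]^d)` which is bounded on the image of a ball under `𝔡𝔦𝔳`
acts on the charges `T_f` as the evaluation at a function of bounded variation. -/
lemma exists_eval_of_bound (hd : 1 ≤ d) (ξ : StrongDual ℝ (StrongDual ℝ (BV d))) {s r : ℝ}
    (hr : 0 < r) (hs : 0 ≤ s)
    (h : ∀ v : C(cube d, Euc d), ‖v‖ ≤ r → ξ (fracDivOperator d v) ≤ s) :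
    ∃ u : BV d, r * (variation u).toReal ≤ s ∧ ∀ α ∈ rangeT d, ξ α = α u := by
  have : Fact (1 ≤ (d : ℝ≥0∞)) := ⟨by exact_mod_cast hd⟩
  have hdt : (d : ℝ≥0∞) ≠ ⊤ := ENNReal.natCast_ne_top d
  have : IsFiniteMeasure (volume.restrict (cube d)) :=
    isFiniteMeasure_restrict.2 (isCompact_cube d).measure_lt_top.ne
  obtain ⟨T, hT⟩ := exists_chargeOperator hd
  have hTf : ∀ (f : Euc d → ℝ) (hf : MemLp f d (volume.restrict (cube d))),
      Represents f (T (hf.toLp f)) := fun f hf => (hT _).congr hf.coeFn_toLp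
  obtain ⟨g, hg, hl⟩ := exists_density hdt (ξ ∘L T)
  set u₀ : Euc d → ℝ := (cube d).indicator g with hu₀
  have hu₀i : Integrable u₀ := (integrable_indicator_iff (measurableSet_cube d)).2 hg
  have hu₀0 : ∀ x ∉ cube d, u₀ x = 0 := fun x hx => indicator_of_notMem hx _
  have hu₀m : ∀ f : Euc d → ℝ, ∫ x in cube d, f x * g x = ∫ x, f x * u₀ x := fun f => by
    rw [← integral_indicator (measurableSet_cube d)]
    congr 1 with x
    by_cases hx : x ∈ cube d <;> simp [u₀, hx]
  -- The divergence of a test field is bounded, so the density formula applies to the charge it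
  -- represents.
  have hdiv : ∀ w (hw : IsTestField w),
      ξ (fracDivOperator d (restrictCube hw.1.continuous)) = ∫ x, u₀ x * divergence w x := by
    intro w hw
    rw [hw.represents_divergence.unique (hTf _ (hw.memLp_divergence d))]
    refine (hl _ _ hw.continuous_divergence.measurable hw.exists_bound_divergence).trans ?_
    rw [hu₀m]
    simp only [mul_comm]
  -- Fields of norm at most `1`, scaled by `r`, lie in the ball where `ξ ∘ 𝔡𝔦𝔳 ≤ s`.
  have hvar : variation u₀ ≤ ENNReal.ofReal (s / r) := by
    refine variation_le_of_forall fun w hw h1 => ?_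
    have h2 := h (r • restrictCube hw.1.continuous) (by
      rw [norm_smul, Real.norm_of_nonneg hr.le]
      exact mul_le_of_le_one_right hr.le ((ContinuousMap.norm_le _ zero_le_one).2 fun x => h1 x))
    rw [map_smul, map_smul, hdiv w hw, smul_eq_mul] at h2
    rwa [le_div_iff₀' hr]
  let u : BV d := BV.mk u₀ hu₀i hu₀0 (hvar.trans_lt ENNReal.ofReal_lt_top)
  have huu : (u : Euc d → ℝ) =ᵐ[volume] u₀ := BV.coeFn_mk hu₀i hu₀0 _
  refine ⟨u, ?_, ?_⟩
  · rw [variation_congr huu, ← le_div_iff₀' hr]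
    exact ENNReal.toReal_le_of_le_ofReal (by positivity) hvar
  -- The density formula covers only bounded functions. Now that `u` is in `BV`, both sides are
  -- continuous in `f ∈ L^d`, and indicators suffice.
  · have hind : ∀ f : Lp ℝ d (volume.restrict (cube d)), ξ (T f) = T f u := by
      refine fun f => Lp.induction hdt (motive := fun f => ξ (T f) = T f u) ?_ ?_ ?_ f
      · intro c A hA hμA
        have hb : ∃ C, ∀ x, ‖A.indicator (fun _ => c) x‖ ≤ C :=
          ⟨‖c‖, fun x => norm_indicator_le_norm_self _ _⟩
        have hm : MemLp (A.indicator fun _ => c) d (volume.restrict (cube d)) :=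
          memLp_indicator_const _ hA c (.inr hμA.ne)
        have h1 : (Lp.simpleFunc.indicatorConst d hA hμA.ne c : Lp ℝ d (volume.restrict (cube d)))
            = hm.toLp _ := Lp.simpleFunc.coe_indicatorConst hA hμA.ne c
        rw [h1, (hTf _ hm u).2, u.setIntegral_mul]
        refine (hl _ hm (measurable_const.indicator hA) hb).trans ?_
        rw [hu₀m]
        exact integral_congr_ae (huu.mono fun x hx => by simp only [hx])
      · intro f g hf hg _ h1 h2
        simp only [map_add, h1, h2, add_apply]
      · exact isClosed_eq (ξ.continuous.comp T.continuous)
          ((ContinuousLinearMap.apply ℝ ℝ u).continuous.comp T.continuous)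
    rintro α ⟨f, hf, hα⟩
    rw [hα.unique (hTf f hf)]
    exact hind _

/-- `C` is the Poincaré constant: it turns the bound on the variation of the function representing a
separating functional into a bound on its `BV` norm. -/
lemma exists_mem_closure_image (hd : 1 ≤ d) :
    ∃ C : ℝ, 0 < C ∧ ∀ α ∈ rangeT d,
      α ∈ closure (fracDivOperator d '' Metric.closedBall 0 (C * ‖α‖)) := by
  obtain ⟨C, hC, hP⟩ := BV.exists_norm_le_variation hd
  refine ⟨C, hC, fun α hα => ?_⟩
  by_contra hcon
  have h0mem : (0 : StrongDual ℝ (BV d))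
      ∈ closure (fracDivOperator d '' Metric.closedBall 0 (C * ‖α‖)) :=
    subset_closure ⟨0, Metric.mem_closedBall_self (by positivity), map_zero _⟩
  have hr : 0 < C * ‖α‖ := by
    refine mul_pos hC (norm_pos_iff.2 ?_)
    rintro rfl
    exact hcon h0mem
  have hconv : Convex ℝ (closure (fracDivOperator d '' Metric.closedBall 0 (C * ‖α‖))) :=
    ((convex_closedBall _ _).linear_image (fracDivOperator d).toLinearMap).closure
  obtain ⟨ξ, s, hξ, hsα⟩ := geometric_hahn_banach_closed_point hconv isClosed_closure hcon
  have hs : 0 < s := by simpa using hξ 0 h0mem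
  obtain ⟨u, hu, hev⟩ := exists_eval_of_bound hd ξ hr hs.le fun v hv =>
    (hξ _ (subset_closure ⟨v, mem_closedBall_zero_iff.2 hv, rfl⟩)).le
  refine absurd hsα (not_lt.2 ?_)
  calc ξ α = α u := hev α hα
    _ ≤ ‖α‖ * ‖u‖ := (le_abs_self _).trans (α.le_opNorm u)
    _ ≤ ‖α‖ * (C * (variation u).toReal) := by
      gcongr
      exact hP u
    _ = C * ‖α‖ * (variation u).toReal := by ring
    _ ≤ s := hu

/-- The operator `𝔡𝔦𝔳 : C([0,1]^d; ℝ^d) → SCH([0,1]^d)`. -/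
def fracDivSCH (d : ℕ) : C(cube d, Euc d) →L[ℝ] SCH d :=
  (fracDivOperator d).codRestrict (SCH d) fracDivOperator_mem_SCH

theorem surjective_fracDivSCH (hd : 1 ≤ d) : Function.Surjective (fracDivSCH d) := by
  obtain ⟨C, hC, hcl⟩ := exists_mem_closure_image hd
  refine surjective_of_approx_preimage (E := C(cube d, Euc d)) (F := SCH d) (fracDivSCH d)
    (C := C * 2) (by positivity) ?_
  rintro ⟨y, hyS⟩
  change ∃ v, ‖fracDivOperator d v - y‖ ≤ 1 / 2 * ‖y‖ ∧ ‖v‖ ≤ C * 2 * ‖y‖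
  rcases eq_or_ne y 0 with rfl | hy
  · exact ⟨0, by simp, by simp⟩
  have hy0 : 0 < ‖y‖ := norm_pos_iff.2 hy
  -- Two errors of `‖y‖ / 4` add up to the allowed `‖y‖ / 2`, and `‖α‖ ≤ 5/4 ‖y‖` fits in the factor
  -- `2` of `C * 2`.
  obtain ⟨α, hα, hyα⟩ := Metric.mem_closure_iff.1 hyS (1 / 4 * ‖y‖) (by positivity)
  obtain ⟨_, ⟨v, hv, rfl⟩, hvα⟩ := Metric.mem_closure_iff.1 (hcl α hα) (1 / 4 * ‖y‖)
    (by positivity)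
  rw [mem_closedBall_zero_iff] at hv
  rw [dist_eq_norm] at hyα hvα
  refine ⟨v, ?_, hv.trans ?_⟩
  · have h2 : fracDivOperator d v - y = -((y - α) + (α - fracDivOperator d v)) := by abel
    rw [h2, norm_neg]
    refine (norm_add_le _ _).trans ?_
    linarith
  · have h3 : ‖α‖ ≤ ‖y‖ + ‖y - α‖ := norm_le_insert _ _
    rw [mul_assoc]
    gcongr
    linarith

end StrongCharge

end

theorem mainTheorem6 (d : ℕ) (hd : 1 ≤ d) :
    (∀ f : Euc d → ℝ, MemLp f d (volume.restrict (cube d)) →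
      ∃ α : StrongDual ℝ (BV d), Represents f α) ∧
    (∀ u : BV d, IsGradient u u.grad) ∧
    ∃ D : C(cube d, Euc d) →L[ℝ] SCH d,
      (∀ (v : C(cube d, Euc d)) (u : BV d),
        (D v : StrongDual ℝ (BV d)) u = fracDiv v u) ∧
      Function.Surjective D := by
  refine ⟨fun f hf => ?_, BV.isGradient_grad, fracDivSCH d, fun v u => rfl,
    surjective_fracDivSCH hd⟩
  have : Fact (1 ≤ (d : ENNReal)) := ⟨by exact_mod_cast hd⟩
  obtain ⟨T, hT⟩ := exists_chargeOperator hd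
  exact ⟨T (hf.toLp f), (hT _).congr hf.coeFn_toLp⟩
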